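/- For $j\in\mathbb Z$ let $\mathscr D_j=\{[2^{-j}k,2^{-j}(k+1)[\,:k\in\mathbb Z\}$, $\mathscr D=\bigcup_{j}\mathscr D_j$, $s_j=(-1)^j2^{-j}/3$, and let $\sigma(\mathscr D)=\bigcup_j\{I+s_j: I\in\mathscr D_j\}$ be the one-third-shifted dyadic grid. For every bounded interval $I=[a,a+|I|[$ let $h_I=1_{[a,a+|I|/2[}-1_{[a+|I|/2,a+|I|[}$. For $I\in\mathscr D$ let $\sigma_0(I)$ (respectively $\sigma_1(I)$) be the unique interval $J\in\sigma(\mathscr D)$ with $|J|=|I|$ and $\sup J\in I$ (respectively $\inf J\in I$). Let $1<p<\infty$ and let $X$ be a Banach space with the UMD property at the exponent $p$. That is, there is a finite constant $K$ such that $\|\sum_{n<N}\varepsilon_n d_n\|_{L^p(\Omega,\mu;X)}\le K\,\|\sum_{n<N}d_n\|_{L^p(\Omega,\mu;X)}$ for all probability spaces $(\Omega,\mu)$, all $X$-valued martingale difference sequences $(d_n)_{n\ge 0}\subset L^p(\Omega,\mu;X)$ (for an arbitrary filtration; $d_0$ need not have mean zero), all signs $\varepsilon_n\in\{-1,1\}$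 and all $N$. Let $\mathscr U_p(X)$ be the least such $K$. Write $L^p_X=L^p(\mathbb R;X)$ with respect to Lebesgue measure. Then for each $\delta\in\{0,1\}$ there is exactly one bounded linear operator $S_\delta:L^p_X\to L^p_X$ with $S_\delta(h_I\,x)=h_{\sigma_\delta(I)}\,x$ for all $I\in\mathscr D$ and $x\in X$. The operators $S_0$ and $S_1$ are isomorphisms of $L^p_X$ onto itself, and there is a constant $C>0$, depending only on $\mathscr U_p(X)$, such that $$\frac1C\,\|u\|_{L^p_X}\le\|S_0u\|_{L^p_X}\le C\,\|u\|_{L^p_X},\qquad \frac1C\,\|u\|_{L^p_X}\le\|S_1u\|_{L^p_X}\le C\,\|u\|_{L^p_X}$$ for all $u\in L^p_X$. -/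

import Mathlib

open MeasureTheory
open scoped ENNReal

noncomputable section

namespace OneThird

/-! ### Half-open intervals and their Haar functions -/

/-- The bounded nonempty interval `[left, left + length[` of the real line. -/
@[ext]
structure Interval where
  left : ℝ
  length : ℝ
  length_pos : 0 < length

namespace Interval

/-- The supremum (right endpoint) of an interval; its infimum is `left`. -/
def right (I : Interval) : ℝ := I.left + I.length

/-- The interval as a set of reals. -/
def toSet (I : Interval) : Set ℝ := Set.Ico I.left I.right

/-- The translate `I + a`. -/
def translate (I : Interval) (a : ℝ) : Interval := ⟨I.left + a, I.length, I.length_pos⟩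

end Interval

/-- The Haar function of `[0, 1[`. -/
def haarUnit (t : ℝ) : ℝ :=
  (Set.Ico (0 : ℝ) (1 / 2)).indicator (fun _ => (1 : ℝ)) t
    - (Set.Ico (1 / 2 : ℝ) 1).indicator (fun _ => (1 : ℝ)) t

/-- The `L^∞`-normalized Haar function of an interval. -/
def haar (I : Interval) (t : ℝ) : ℝ := haarUnit ((t - I.left) / I.length)

/-! ### Dyadic intervals, the one-third-shift and the unilateral shifts -/

/-- The dyadic interval `[2^{-j} k, 2^{-j} (k + 1)[`. -/
def dyadic (j k : ℤ) : Interval := ⟨(2 : ℝ) ^ (-j) * k, (2 : ℝ) ^ (-j), by positivity⟩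

/-- The dyadic intervals of length `2^{-j}`. -/
def dyadicLevel (j : ℤ) : Set Interval := Set.range (dyadic j)

/-- The collection `𝒟` of all dyadic intervals. -/
def dyadicGrid : Set Interval := ⋃ j : ℤ, dyadicLevel j

/-- The signed shift width `s_j = (-1)^j 2^{-j} / 3`. -/
def shiftWidth (j : ℤ) : ℝ := (-1 : ℝ) ^ j * (2 : ℝ) ^ (-j) / 3

/-- The one-third-shifted grid `σ(𝒟)`, where `σ(I) = I + s_j` if `|I| = 2^{-j}`. -/
def shiftedGrid : Set Interval :=
  ⋃ j : ℤ, (fun I : Interval => I.translate (shiftWidth j)) '' dyadicLevel j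

theorem existsUnique_shifted_aux (I : Interval) (hI : I ∈ dyadicGrid) (r : ℤ) :
    ∃! J : Interval, J ∈ shiftedGrid ∧ J.length = I.length ∧
      J.left + r * J.length ∈ I.toSet := by
  simp only [dyadicGrid, dyadicLevel, Set.mem_iUnion, Set.mem_range] at hI
  obtain ⟨j, k, rfl⟩ := hI
  have hpos : (0 : ℝ) < (2 : ℝ) ^ (-j) := by positivity
  have hmem : ∀ l : ℤ, ((dyadic j l).translate (shiftWidth j)).left
      + r * ((dyadic j l).translate (shiftWidth j)).length ∈ (dyadic j k).toSet ↔
      (k : ℝ) ≤ l + (-1 : ℝ) ^ j / 3 + r ∧ (l : ℝ) + (-1 : ℝ) ^ j / 3 + r < k + 1 := by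
    intro l
    have e : (2 : ℝ) ^ (-j) * l + (-1 : ℝ) ^ j * (2 : ℝ) ^ (-j) / 3 + r * (2 : ℝ) ^ (-j)
        = (2 : ℝ) ^ (-j) * (l + (-1 : ℝ) ^ j / 3 + r) := by ring
    have e' : (2 : ℝ) ^ (-j) * k + (2 : ℝ) ^ (-j) = (2 : ℝ) ^ (-j) * (k + 1) := by ring
    simp only [Interval.toSet, Interval.right, Interval.translate, dyadic, shiftWidth,
      Set.mem_Ico, e, e']
    rw [mul_le_mul_iff_right₀ hpos, mul_lt_mul_iff_right₀ hpos]
  have hsgn : (-1 : ℝ) ^ j = 1 ∨ (-1 : ℝ) ^ j = -1 := by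
    rcases Int.even_or_odd j with h | h
    · exact Or.inl h.neg_one_zpow
    · exact Or.inr h.neg_one_zpow
  have huniq : ∃! l : ℤ, (k : ℝ) ≤ l + (-1 : ℝ) ^ j / 3 + r ∧
      (l : ℝ) + (-1 : ℝ) ^ j / 3 + r < k + 1 := by
    refine ⟨⌈(k : ℝ) - (-1 : ℝ) ^ j / 3 - r⌉, ⟨?_, ?_⟩, ?_⟩
    · have := Int.le_ceil ((k : ℝ) - (-1 : ℝ) ^ j / 3 - r)
      linarith
    · have := Int.ceil_lt_add_one ((k : ℝ) - (-1 : ℝ) ^ j / 3 - r)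
      linarith
    · rintro l ⟨h1, h2⟩
      symm
      rw [Int.ceil_eq_iff]
      constructor <;> linarith
  obtain ⟨l, hl, hl'⟩ := huniq
  refine ⟨(dyadic j l).translate (shiftWidth j), ⟨?_, rfl, (hmem l).2 hl⟩, ?_⟩
  · exact Set.mem_iUnion.2 ⟨j, dyadic j l, ⟨l, rfl⟩, rfl⟩
  · rintro J ⟨hJ, hlen, hJm⟩
    obtain ⟨i, I', ⟨m, rfl⟩, rfl⟩ := Set.mem_iUnion.1 hJ
    have hij : i = j := by
      have h2 : (2 : ℝ) ^ (-i) = (2 : ℝ) ^ (-j) := hlen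
      have := zpow_right_injective₀ (by norm_num : (0 : ℝ) < 2) (by norm_num) h2
      exact neg_injective this
    subst hij
    rw [hl' m ((hmem m).1 hJm)]

theorem existsUnique_shifted_right_mem (I : Interval) (hI : I ∈ dyadicGrid) :
    ∃! J : Interval, J ∈ shiftedGrid ∧ J.length = I.length ∧ J.right ∈ I.toSet := by
  simpa [Interval.right] using existsUnique_shifted_aux I hI 1

theorem existsUnique_shifted_left_mem (I : Interval) (hI : I ∈ dyadicGrid) :
    ∃! J : Interval, J ∈ shiftedGrid ∧ J.length = I.length ∧ J.left ∈ I.toSet := by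
  simpa using existsUnique_shifted_aux I hI 0

/-- `σ₀(I)` is the unique `J ∈ σ(𝒟)` with `|J| = |I|` and `sup J ∈ I`. -/
def sigmaZero (I : dyadicGrid) : shiftedGrid :=
  ⟨(existsUnique_shifted_right_mem I I.2).choose,
    (existsUnique_shifted_right_mem I I.2).choose_spec.1.1⟩

/-- `σ₁(I)` is the unique `J ∈ σ(𝒟)` with `|J| = |I|` and `inf J ∈ I`. -/
def sigmaOne (I : dyadicGrid) : shiftedGrid :=
  ⟨(existsUnique_shifted_left_mem I I.2).choose,
    (existsUnique_shifted_left_mem I I.2).choose_spec.1.1⟩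

/-! ### The UMD constant -/

/-- `d` is a martingale difference sequence for the filtration `ℱ`: it is adapted, integrable,
and `E(d_{n+1} | ℱ_n) = 0` for all `n`. -/
def IsMartingaleDifference {Ω : Type*} {X : Type*} [NormedAddCommGroup X] [NormedSpace ℝ X]
    [CompleteSpace X] {m : MeasurableSpace Ω} (d : ℕ → Ω → X) (ℱ : Filtration ℕ m)
    (μ : Measure Ω) : Prop :=
  StronglyAdapted ℱ d ∧ (∀ n, Integrable (d n) μ) ∧ ∀ n, μ[d (n + 1) | ℱ n] =ᵐ[μ] 0

/-- `K` is an admissible constant in the `L^p`-inequality defining the UMD property of `X`. -/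
def UMDInequality (p : ℝ≥0∞) (X : Type*) [NormedAddCommGroup X] [NormedSpace ℝ X]
    [CompleteSpace X] (K : ℝ≥0∞) : Prop :=
  ∀ (Ω : Type) (m : MeasurableSpace Ω) (μ : Measure Ω) (_ : IsProbabilityMeasure μ)
    (ℱ : Filtration ℕ m) (d : ℕ → Ω → X),
    IsMartingaleDifference d ℱ μ → (∀ n, MemLp (d n) p μ) →
    ∀ ε : ℕ → ℝ, (∀ n, ε n = 1 ∨ ε n = -1) → ∀ N : ℕ,
      eLpNorm (fun ω => ∑ n ∈ Finset.range N, ε n • d n ω) p μ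
        ≤ K * eLpNorm (fun ω => ∑ n ∈ Finset.range N, d n ω) p μ

/-- The UMD constant `𝒰_p(X)`, the least admissible constant (`∞` if there is none). -/
def umdConstant (p : ℝ≥0∞) (X : Type*) [NormedAddCommGroup X] [NormedSpace ℝ X]
    [CompleteSpace X] : ℝ≥0∞ :=
  sInf {K | UMDInequality p X K}

/-- The UMD property of `X`, at the exponent `p`. -/
def IsUMD (p : ℝ≥0∞) (X : Type*) [NormedAddCommGroup X] [NormedSpace ℝ X]
    [CompleteSpace X] : Prop :=
  umdConstant p X < ∞

/-! ### Haar functions in `L^p_X` and shift operators -/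

theorem memLp_haar_smul (p : ℝ≥0∞) {X : Type*} [NormedAddCommGroup X] [NormedSpace ℝ X]
    (I : Interval) (x : X) : MemLp (fun t : ℝ => haar I t • x) p volume := by
  have hdiv : Measurable fun t : ℝ => (t - I.left) / I.length := by fun_prop
  have hmeas : Measurable haarUnit :=
    (measurable_const.indicator measurableSet_Ico).sub
      (measurable_const.indicator measurableSet_Ico)
  have hbound : ∀ t, ‖haarUnit t‖ ≤ 2 := by
    intro t
    refine (norm_sub_le _ _).trans ?_
    have h1 := norm_indicator_le_norm_self (s := Set.Ico (0 : ℝ) (1 / 2)) (fun _ => (1 : ℝ)) t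
    have h2 := norm_indicator_le_norm_self (s := Set.Ico (1 / 2 : ℝ) 1) (fun _ => (1 : ℝ)) t
    rw [norm_one] at h1 h2
    linarith
  have hsupp : ∀ t, t ∉ I.toSet → haar I t = 0 := by
    intro t ht
    have hcase : (t - I.left) / I.length < 0 ∨ 1 ≤ (t - I.left) / I.length := by
      by_contra! hcon
      apply ht
      obtain ⟨h1, h2⟩ := hcon
      have h3 : 0 ≤ t - I.left := by
        by_contra! h
        exact absurd (div_neg_of_neg_of_pos h I.length_pos) (not_lt.2 h1)
      rw [div_lt_one I.length_pos] at h2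
      exact ⟨by linarith, by simp only [Interval.right]; linarith⟩
    have h1 : (t - I.left) / I.length ∉ Set.Ico (0 : ℝ) (1 / 2) := by
      rintro ⟨_, _⟩; rcases hcase with h | h <;> linarith
    have h2 : (t - I.left) / I.length ∉ Set.Ico (1 / 2 : ℝ) 1 := by
      rintro ⟨_, _⟩; rcases hcase with h | h <;> linarith
    simp only [haar, haarUnit, Set.indicator_of_notMem h1, Set.indicator_of_notMem h2, sub_zero]
  have hind : (fun t : ℝ => haar I t • x) = I.toSet.indicator (fun t : ℝ => haar I t • x) := by
    symm
    rw [Set.indicator_eq_self]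
    intro t ht
    by_contra hn
    exact ht (by simp only [hsupp t hn, zero_smul])
  have hS : MeasurableSet I.toSet := measurableSet_Ico
  rw [hind, memLp_indicator_iff_restrict hS]
  have : IsFiniteMeasure (volume.restrict I.toSet) := by
    simp only [Interval.toSet]; infer_instance
  refine MemLp.of_bound ?_ (2 * ‖x‖) (Filter.Eventually.of_forall fun t => ?_)
  · exact ((hmeas.comp hdiv).stronglyMeasurable.smul_const x).aestronglyMeasurable
  · rw [norm_smul]
    exact mul_le_mul_of_nonneg_right (hbound _) (norm_nonneg x)

/-- The function `t ↦ h_I(t) x` as an element of `L^p_X = L^p(ℝ; X)`. -/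
def haarLp (p : ℝ≥0∞) {X : Type*} [NormedAddCommGroup X] [NormedSpace ℝ X]
    (I : Interval) (x : X) : Lp X p (volume : Measure ℝ) :=
  (memLp_haar_smul p I x).toLp (fun t : ℝ => haar I t • x)

/-- The bounded operator `T` on `L^p_X` acts on the Haar system by `h_I ↦ h_{τ(I)}`, `I ∈ 𝒟`
(with arbitrary coefficients from `X`). -/
def ActsOnHaarBy {p : ℝ≥0∞} [Fact (1 ≤ p)] {X : Type*} [NormedAddCommGroup X]
    [NormedSpace ℝ X] (τ : dyadicGrid → shiftedGrid)
    (T : Lp X p (volume : Measure ℝ) →L[ℝ] Lp X p (volume : Measure ℝ)) : Prop :=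
  ∀ (I : dyadicGrid) (x : X), T (haarLp p (I : Interval) x) = haarLp p (τ I : Interval) x

end OneThird

end

namespace OneThird

/-! ### Nested grids of binary intervals -/

/-! Both grids consist of cells `[c j + 2^{-j} k, c j + 2^{-j} (k + 1)[` indexed by the same pairs
`(j, k)`. The maps `σ₀` and `σ₁` keep `(j, k)` and replace the offset `0` by `offsetZero` or
`offsetOne`, a displacement by one or two thirds of the length. So the core of the theorem is that
finite Haar sums with equal coefficients over the two grids have equivalent norms. Since `p > 1`,
Haar sums are dense (`denseRange_haarSynthesis`), and the correspondence extends to an isomorphism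
(`exists_equiv_of_denseRange`).

Let `x_j(t)` be the coefficient of the cell of level `j` containing `t`, `r_j` the Haar sign and
`ε_j` a random sign. The UMD inequality and Kahane's contraction principle compare `∑ r_j x_j` with
the randomized sum `∑ ε_j x_j` in both directions (`haarSum_le_randomSum`, `randomSum_le_haarSum`).
By contraction, the norm of the randomized sum does not grow when each `x_j` is cut down to a part
of the cells. The displacement is at most three quarters of the length, so a whole quarter of each
cell lies in the cell of the other grid with the same index, and on it the coefficient functions
agree.

It remains to recover full cells from quarters (`randomSum_le_quarter`), which is Bourgain's form of
Stein's inequality. The indicator `(1 + η r_j)(1 + η r_{j+1}) / 4` of a quarter has mean `1/4` on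
its cell. Hence the randomized sum over quarters is a martingale whose steps are alternately sign
steps `ε_j x_j / 4` and Haar steps. Reversing the Haar steps costs a factor `K`, and adding the
result to the original sum leaves half the randomized sum.

Independence and conditional expectations enter only through the maps `flip`, which preserve
measure, reverse one Haar sign and fix all the others. -/

/-- The coordinate of `t` in units of `2^{-j}`, relative to the offset `c j`. -/
noncomputable def coord (c : ℤ → ℝ) (j : ℤ) (t : ℝ) : ℝ := (2 : ℝ) ^ j * (t - c j)

/-- The index `k` of the interval `[c j + 2^{-j} k, c j + 2^{-j} (k + 1)[` containing `t`. -/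
noncomputable def idx (c : ℤ → ℝ) (j : ℤ) (t : ℝ) : ℤ := ⌊coord c j t⌋

/-- The value at `t` of the Haar function of the interval of level `j` containing `t`. -/
noncomputable def rad (c : ℤ → ℝ) (j : ℤ) (t : ℝ) : ℝ :=
  if Int.fract (coord c j t) < 1 / 2 then 1 else -1

/-- The map exchanging the two halves of each interval of level `j`. -/
noncomputable def flip (c : ℤ → ℝ) (j : ℤ) (t : ℝ) : ℝ := t + rad c j t * (2 : ℝ) ^ (-(j + 1))

/-- The offsets `c` define a nested family of grids. -/
def Nested (c : ℤ → ℝ) : Prop := ∀ j, ∃ n : ℤ, (2 : ℝ) ^ (j + 1) * (c j - c (j + 1)) = n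

theorem nested_zero : Nested 0 := fun _ => ⟨0, by simp⟩

theorem rad_eq (c : ℤ → ℝ) (j : ℤ) (t : ℝ) : rad c j t = 1 ∨ rad c j t = -1 := by
  unfold rad; split_ifs <;> simp

theorem rad_mul_self (c : ℤ → ℝ) (j : ℤ) (t : ℝ) : rad c j t * rad c j t = 1 := by
  rcases rad_eq c j t with h | h <;> rw [h] <;> norm_num

theorem abs_rad (c : ℤ → ℝ) (j : ℤ) (t : ℝ) : |rad c j t| = 1 := by
  rcases rad_eq c j t with h | h <;> rw [h] <;> norm_num

theorem two_zpow_succ (j : ℤ) : (2 : ℝ) ^ (j + 1) = 2 * 2 ^ j := by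
  rw [zpow_add₀ (by norm_num)]; ring

@[fun_prop]
theorem measurable_coord (c : ℤ → ℝ) (j : ℤ) : Measurable (coord c j) := by
  unfold coord; fun_prop

@[fun_prop]
theorem measurable_idx (c : ℤ → ℝ) (j : ℤ) : Measurable (idx c j) :=
  Int.measurable_floor.comp (measurable_coord c j)

@[fun_prop]
theorem measurable_rad (c : ℤ → ℝ) (j : ℤ) : Measurable (rad c j) :=
  Measurable.ite (measurableSet_lt ((measurable_coord c j).fract) measurable_const)
    measurable_const measurable_const

@[fun_prop]
theorem measurable_flip (c : ℤ → ℝ) (j : ℤ) : Measurable (flip c j) := by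
  unfold flip; fun_prop

theorem coord_add (c : ℤ → ℝ) (j : ℤ) (t h : ℝ) :
    coord c j (t + h) = coord c j t + 2 ^ j * h := by
  unfold coord; ring

theorem floor_two_mul (y : ℝ) :
    ⌊2 * y⌋ = 2 * ⌊y⌋ + (if Int.fract y < 1 / 2 then 0 else 1) := by
  have h0 := Int.fract_nonneg y
  have h1 := Int.fract_lt_one y
  have h2 := Int.floor_add_fract y
  rw [Int.floor_eq_iff]
  split_ifs with h <;> push_cast <;> constructor <;> linarith

/-- The index at level `j + 1` determines, and is determined by, the index at level `j` and the
half of the interval. -/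
theorem idx_succ {c : ℤ → ℝ} (hc : Nested c) (j : ℤ) :
    ∃ n : ℤ, ∀ t, idx c (j + 1) t = 2 * idx c j t + (if rad c j t = 1 then 0 else 1) + n := by
  obtain ⟨n, hn⟩ := hc j
  refine ⟨n, fun t => ?_⟩
  have e : coord c (j + 1) t = 2 * coord c j t + n := by
    rw [← hn]; unfold coord; rw [two_zpow_succ]; ring
  have e2 : (if rad c j t = 1 then (0 : ℤ) else 1)
      = if Int.fract (coord c j t) < 1 / 2 then 0 else 1 := by
    unfold rad; split_ifs with h1 h2 <;> first | rfl | (norm_num at *)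
  rw [e2, idx, e, Int.floor_add_intCast, floor_two_mul, idx]

theorem idx_factor_succ {c : ℤ → ℝ} (hc : Nested c) (j : ℤ) :
    ∃ g : ℤ → ℤ, ∀ t, idx c j t = g (idx c (j + 1) t) := by
  obtain ⟨n, hn⟩ := idx_succ hc j
  refine ⟨fun m => (m - n) / 2, fun t => ?_⟩
  have := hn t
  simp only
  split_ifs at this <;> omega

theorem rad_factor {c : ℤ → ℝ} (hc : Nested c) (j : ℤ) :
    ∃ g : ℤ → ℝ, ∀ t, rad c j t = g (idx c (j + 1) t) := by
  obtain ⟨n, hn⟩ := idx_succ hc j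
  refine ⟨fun m => if (m - n) % 2 = 0 then 1 else -1, fun t => ?_⟩
  have h := hn t
  have h2 := rad_eq c j t
  by_cases h1 : rad c j t = 1
  · rw [if_pos h1] at h
    simp only
    rw [if_pos (by omega), h1]
  · rw [if_neg h1] at h
    simp only
    rw [if_neg (by omega)]
    tauto

theorem idx_factor {c : ℤ → ℝ} (hc : Nested c) {i j : ℤ} (hij : i ≤ j) :
    ∃ g : ℤ → ℤ, ∀ t, idx c i t = g (idx c j t) := by
  induction j, hij using Int.leInduction with
  | base => exact ⟨id, fun _ => rfl⟩
  | succ j _ ih =>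
    obtain ⟨g, hg⟩ := ih
    obtain ⟨g', hg'⟩ := idx_factor_succ hc j
    exact ⟨g ∘ g', fun t => by rw [hg, hg']; rfl⟩

theorem idx_congr {c : ℤ → ℝ} (hc : Nested c) {i j : ℤ} (hij : i ≤ j) {t t' : ℝ}
    (h : idx c j t = idx c j t') : idx c i t = idx c i t' := by
  obtain ⟨g, hg⟩ := idx_factor hc hij
  rw [hg, hg, h]

theorem rad_congr {c : ℤ → ℝ} (hc : Nested c) {i j : ℤ} (hij : i < j) {t t' : ℝ}
    (h : idx c j t = idx c j t') : rad c i t = rad c i t' := by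
  obtain ⟨g, hg⟩ := rad_factor hc i
  rw [hg, hg, idx_congr hc hij h]

theorem coord_flip_self (c : ℤ → ℝ) (j : ℤ) (t : ℝ) :
    coord c j (flip c j t) = coord c j t + rad c j t / 2 := by
  rw [flip, coord_add, neg_add, zpow_add₀ (by norm_num), zpow_neg]
  have : (2 : ℝ) ^ j ≠ 0 := by positivity
  field_simp

theorem idx_flip_self (c : ℤ → ℝ) (j : ℤ) (t : ℝ) : idx c j (flip c j t) = idx c j t := by
  rw [idx, coord_flip_self, idx, Int.floor_eq_iff]
  have h0 := Int.fract_nonneg (coord c j t)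
  have h1 := Int.fract_lt_one (coord c j t)
  have h2 := Int.floor_add_fract (coord c j t)
  unfold rad
  split_ifs <;> constructor <;> linarith

theorem fract_coord_flip_self (c : ℤ → ℝ) (j : ℤ) (t : ℝ) :
    Int.fract (coord c j (flip c j t)) = Int.fract (coord c j t) + rad c j t / 2 := by
  have h := idx_flip_self c j t
  unfold idx at h
  rw [← Int.self_sub_floor, h, coord_flip_self, ← Int.self_sub_floor]; ring

theorem rad_flip_self (c : ℤ → ℝ) (j : ℤ) (t : ℝ) : rad c j (flip c j t) = -rad c j t := by
  have h := fract_coord_flip_self c j t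
  have h0 := Int.fract_nonneg (coord c j t)
  have h1 := Int.fract_lt_one (coord c j t)
  by_cases h2 : Int.fract (coord c j t) < 1 / 2
  · have e : rad c j t = 1 := if_pos h2
    rw [e] at h ⊢
    rw [rad, if_neg (by linarith)]
  · have e : rad c j t = -1 := if_neg h2
    rw [e] at h ⊢
    rw [rad, if_pos (by linarith)]; norm_num

theorem idx_flip_of_le {c : ℤ → ℝ} (hc : Nested c) {i j : ℤ} (hij : i ≤ j) (t : ℝ) :
    idx c i (flip c j t) = idx c i t := by
  obtain ⟨g, hg⟩ := idx_factor hc hij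
  rw [hg, hg, idx_flip_self]

/-- Coarser signs depend only on the cell, which the flip preserves. For finer levels the flip
translates by `± 2^{-(j+1)}`, a whole number of cells. -/
theorem rad_flip_of_ne {c : ℤ → ℝ} (hc : Nested c) {i j : ℤ} (hij : i ≠ j) (t : ℝ) :
    rad c i (flip c j t) = rad c i t := by
  rcases lt_or_gt_of_ne hij with h | h
  · obtain ⟨g, hg⟩ := rad_factor hc i
    rw [hg, hg, idx_flip_of_le hc (by omega)]
  · obtain ⟨n, rfl⟩ : ∃ n : ℕ, i = j + 1 + n := ⟨(i - (j + 1)).toNat, by omega⟩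
    have e : (2 : ℝ) ^ (j + 1 + (n : ℤ)) * (rad c j t * 2 ^ (-(j + 1))) = rad c j t * 2 ^ n := by
      rw [zpow_add₀ (by norm_num), zpow_neg, zpow_natCast]
      have : (2 : ℝ) ^ (j + 1) ≠ 0 := by positivity
      field_simp
    have e' : ∃ m : ℤ, rad c j t * 2 ^ n = m := by
      rcases rad_eq c j t with h | h
      · exact ⟨2 ^ n, by rw [h]; push_cast; ring⟩
      · exact ⟨-2 ^ n, by rw [h]; push_cast; ring⟩
    obtain ⟨m, hm⟩ := e'
    rw [rad, rad, flip, coord_add, e, hm, Int.fract_add_intCast]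

/-! ### The half-exchanging maps preserve the measure -/

/-- The map is a translation on each of the sets `rad = 1` and `rad = -1`, and it exchanges them. -/
theorem measurePreserving_flip (c : ℤ → ℝ) (j : ℤ) : MeasurePreserving (flip c j) := by
  refine ⟨measurable_flip c j, ?_⟩
  set h : ℝ := 2 ^ (-(j + 1)) with hh
  have key : ∀ s : Set ℝ, MeasurableSet s → ∀ σ : ℝ, (σ = 1 ∨ σ = -1) →
      volume (flip c j ⁻¹' s ∩ {t | rad c j t = σ}) = volume (s ∩ {t | rad c j t = -σ}) := by
    intro s hs σ hσ
    have : flip c j ⁻¹' s ∩ {t | rad c j t = σ}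
        = (fun t => t + σ * h) ⁻¹' (s ∩ {t | rad c j t = -σ}) := by
      ext t
      simp only [Set.mem_inter_iff, Set.mem_preimage, Set.mem_ofPred_eq]
      constructor
      · rintro ⟨h1, h2⟩
        have : flip c j t = t + σ * h := by rw [flip, h2]
        rw [← this, rad_flip_self, h2]
        exact ⟨h1, rfl⟩
      · rintro ⟨h1, h2⟩
        have e : flip c j (t + σ * h) = t := by rw [flip, h2]; ring
        have e2 : rad c j t = σ := by
          rw [← e, rad_flip_self, h2, neg_neg]
        refine ⟨?_, e2⟩
        rwa [flip, e2]
    rw [this, measure_preimage_add_right]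
  have meas : ∀ σ : ℝ, MeasurableSet {t | rad c j t = σ} := fun σ =>
    measurable_rad c j (measurableSet_singleton σ)
  have split : ∀ s : Set ℝ,
      volume s = volume (s ∩ {t | rad c j t = 1}) + volume (s ∩ {t | rad c j t = -1}) := by
    intro s
    rw [← measure_inter_add_sdiff s (meas 1)]
    congr 2
    ext t
    simp only [Set.mem_sdiff, Set.mem_inter_iff, Set.mem_ofPred_eq]
    rcases rad_eq c j t with h | h <;> rw [h] <;> norm_num
  ext s hs
  rw [Measure.map_apply (measurable_flip c j) hs, split, split s, key s hs 1 (by simp),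
    key s hs (-1) (by simp), add_comm, neg_neg]

theorem measurePreserving_flip_restrict {c : ℤ → ℝ} (hc : Nested c) {a j : ℤ} (haj : a ≤ j)
    (k : ℤ) : MeasurePreserving (flip c j) (volume.restrict (idx c a ⁻¹' {k}))
      (volume.restrict (idx c a ⁻¹' {k})) := by
  have h := (measurePreserving_flip c j).restrict_preimage
    (measurable_idx c a (measurableSet_singleton k))
  have e : flip c j ⁻¹' (idx c a ⁻¹' {k}) = idx c a ⁻¹' {k} := by
    ext t; simp [idx_flip_of_le hc haj]
  rwa [e] at h

theorem idx_eq_iff (c : ℤ → ℝ) (j k : ℤ) (t : ℝ) :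
    idx c j t = k ↔ t ∈ Set.Ico (c j + 2 ^ (-j) * k) (c j + 2 ^ (-j) * k + 2 ^ (-j)) := by
  have h : (0 : ℝ) < 2 ^ j := by positivity
  rw [idx, Int.floor_eq_iff, coord, Set.mem_Ico, zpow_neg,
    show (c j + ((2 : ℝ) ^ j)⁻¹ * k ≤ t) ↔ (k : ℝ) ≤ 2 ^ j * (t - c j) by
      rw [← sub_nonneg, ← sub_nonneg (b := (k : ℝ)),
        show t - (c j + ((2 : ℝ) ^ j)⁻¹ * k) = (2 ^ j)⁻¹ * (2 ^ j * (t - c j) - k) by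
          field_simp; ring, mul_nonneg_iff_of_pos_left (by positivity)],
    show (t < c j + ((2 : ℝ) ^ j)⁻¹ * k + ((2 : ℝ) ^ j)⁻¹) ↔ 2 ^ j * (t - c j) < (k : ℝ) + 1 by
      rw [← sub_pos, ← sub_pos (a := (k : ℝ) + 1),
        show c j + ((2 : ℝ) ^ j)⁻¹ * k + ((2 : ℝ) ^ j)⁻¹ - t
          = (2 ^ j)⁻¹ * (k + 1 - 2 ^ j * (t - c j)) by field_simp; ring,
        mul_pos_iff_of_pos_left (by positivity)]]

theorem preimage_idx (c : ℤ → ℝ) (j k : ℤ) : idx c j ⁻¹' {k}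
    = Set.Ico (c j + 2 ^ (-j) * k) (c j + 2 ^ (-j) * k + 2 ^ (-j)) := by
  ext t; exact idx_eq_iff c j k t

theorem volume_preimage_idx (c : ℤ → ℝ) (j k : ℤ) :
    volume (idx c j ⁻¹' {k}) = ENNReal.ofReal (2 ^ (-j)) := by
  rw [preimage_idx, Real.volume_Ico]; congr 1; ring

/-! ### Comparison of `L^p`-norms on pieces and on slices -/

section Comparison

variable {X : Type*} [NormedAddCommGroup X] {p : ℝ≥0∞}

theorem eLpNorm_le_mul_iff {α β : Type*} {mα : MeasurableSpace α} {mβ : MeasurableSpace β}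
    {μ : Measure α} {ν : Measure β} {f : α → X} {g : β → X} (hp : 1 ≤ p) (hp' : p ≠ ∞)
    (K : ℝ≥0∞) : eLpNorm f p μ ≤ K * eLpNorm g p ν ↔
      ∫⁻ a, ‖f a‖ₑ ^ p.toReal ∂μ ≤ K ^ p.toReal * ∫⁻ b, ‖g b‖ₑ ^ p.toReal ∂ν := by
  have h0 : p ≠ 0 := (zero_lt_one.trans_le hp).ne'
  have hpos : 0 < p.toReal := ENNReal.toReal_pos h0 hp'
  rw [eLpNorm_eq_lintegral_rpow_enorm_toReal h0 hp', eLpNorm_eq_lintegral_rpow_enorm_toReal h0 hp',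
    ← ENNReal.rpow_le_rpow_iff hpos, ENNReal.mul_rpow_of_nonneg _ _ hpos.le, ← ENNReal.rpow_mul,
    ← ENNReal.rpow_mul, one_div, inv_mul_cancel₀ hpos.ne', ENNReal.rpow_one, ENNReal.rpow_one]

/-- The UMD inequality concerns probability spaces, while Haar sums live on the whole line. This
lemma glues the estimates on the cells of the coarsest level, whose constant is uniform. -/
theorem eLpNorm_le_of_partition {α : Type*} {mα : MeasurableSpace α} {μ : Measure α}
    {f g : α → X} (hp : 1 ≤ p) (hp' : p ≠ ∞) {K : ℝ≥0∞} {φ : α → ℤ} (hφ : Measurable φ)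
    (h : ∀ k, eLpNorm f p (μ.restrict (φ ⁻¹' {k})) ≤ K * eLpNorm g p (μ.restrict (φ ⁻¹' {k}))) :
    eLpNorm f p μ ≤ K * eLpNorm g p μ := by
  rw [eLpNorm_le_mul_iff hp hp']
  have key : ∀ u : α → ℝ≥0∞, ∫⁻ a, u a ∂μ = ∑' k, ∫⁻ a in φ ⁻¹' {k}, u a ∂μ := by
    intro u
    rw [← lintegral_iUnion (fun k => hφ (measurableSet_singleton k))]
    · rw [← Set.preimage_iUnion, Set.iUnion_of_singleton, Set.preimage_univ, Measure.restrict_univ]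
    · intro i j hij
      exact Disjoint.preimage _ (by simpa using hij)
  rw [key, key, ← ENNReal.tsum_mul_left]
  exact ENNReal.tsum_le_tsum fun k => (eLpNorm_le_mul_iff hp hp' K).1 (h k)

/-- Fubini for `p`-th powers: one variable may be frozen, so that signs depending on it become
constants. -/
theorem eLpNorm_prod_le {α β : Type*} {mα : MeasurableSpace α} {mβ : MeasurableSpace β}
    {μ : Measure α} {ν : Measure β} [SFinite μ] [SFinite ν] {f g : α × β → X}
    (hp : 1 ≤ p) (hp' : p ≠ ∞) {K : ℝ≥0∞} (hf : StronglyMeasurable f) (hg : StronglyMeasurable g)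
    (h : ∀ a, eLpNorm (fun b => f (a, b)) p ν ≤ K * eLpNorm (fun b => g (a, b)) p ν) :
    eLpNorm f p (μ.prod ν) ≤ K * eLpNorm g p (μ.prod ν) := by
  have mf : Measurable fun z => ‖f z‖ₑ ^ p.toReal := hf.enorm.pow_const _
  have mg : Measurable fun z => ‖g z‖ₑ ^ p.toReal := hg.enorm.pow_const _
  rw [eLpNorm_le_mul_iff hp hp', lintegral_prod _ mf.aemeasurable, lintegral_prod _ mg.aemeasurable,
    ← lintegral_const_mul _ mg.lintegral_prod_right']
  exact lintegral_mono fun a => (eLpNorm_le_mul_iff hp hp' K).1 (h a)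

theorem eLpNorm_prod_le_symm {α β : Type*} {mα : MeasurableSpace α} {mβ : MeasurableSpace β}
    {μ : Measure α} {ν : Measure β} [SFinite μ] [SFinite ν] {f g : α × β → X}
    (hp : 1 ≤ p) (hp' : p ≠ ∞) {K : ℝ≥0∞} (hf : StronglyMeasurable f) (hg : StronglyMeasurable g)
    (h : ∀ b, eLpNorm (fun a => f (a, b)) p μ ≤ K * eLpNorm (fun a => g (a, b)) p μ) :
    eLpNorm f p (μ.prod ν) ≤ K * eLpNorm g p (μ.prod ν) := by
  have mf : Measurable fun z => ‖f z‖ₑ ^ p.toReal := hf.enorm.pow_const _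
  have mg : Measurable fun z => ‖g z‖ₑ ^ p.toReal := hg.enorm.pow_const _
  rw [eLpNorm_le_mul_iff hp hp', lintegral_prod_symm _ mf.aemeasurable,
    lintegral_prod_symm _ mg.aemeasurable, ← lintegral_const_mul _ mg.lintegral_prod_left']
  exact lintegral_mono fun a => (eLpNorm_le_mul_iff hp hp' K).1 (h a)

end Comparison

/-! ### Kahane's contraction principle -/

/-- Coefficients are contracted one at a time. Changing one sign preserves the norm, and a
coefficient in `[-1, 1]` is a convex combination of `1` and `-1`. -/
theorem eLpNorm_sum_le_of_flip {X : Type*} [NormedAddCommGroup X] [NormedSpace ℝ X] {p : ℝ≥0∞}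
    (hp : 1 ≤ p) {S ι : Type*} {mS : MeasurableSpace S} {ν : Measure S} (s : Finset ι)
    (ε : ι → S → ℝ) (Φ : ι → S → S) (hε : ∀ i, Measurable (ε i))
    (hΦ : ∀ i ∈ s, MeasurePreserving (Φ i) ν ν)
    (hneg : ∀ i ∈ s, ∀ ω, ε i (Φ i ω) = -ε i ω)
    (hfix : ∀ i ∈ s, ∀ j, j ≠ i → ∀ ω, ε j (Φ i ω) = ε j ω)
    (θ : ι → ℝ) (hθ : ∀ i, |θ i| ≤ 1) (y : ι → X) :
    eLpNorm (fun ω => ∑ i ∈ s, ε i ω • θ i • y i) p ν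
      ≤ eLpNorm (fun ω => ∑ i ∈ s, ε i ω • y i) p ν := by
  classical
  -- The induction needs room for the terms already treated; `g` collects them, and invariance under
  -- the remaining maps is all that is kept of them.
  suffices H : ∀ g : S → X, StronglyMeasurable g → (∀ i ∈ s, ∀ ω, g (Φ i ω) = g ω) →
      eLpNorm (fun ω => g ω + ∑ i ∈ s, ε i ω • θ i • y i) p ν
        ≤ eLpNorm (fun ω => g ω + ∑ i ∈ s, ε i ω • y i) p ν by
    simpa using H 0 stronglyMeasurable_zero (by simp)
  have hm : ∀ i (x : X), StronglyMeasurable fun ω => ε i ω • x := fun i x =>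
    (hε i).stronglyMeasurable.smul_const x
  induction s using Finset.induction_on with
  | empty => intro g _ _; simp
  | insert i s hi ih =>
    intro g hg hinv
    have hne : ∀ j ∈ s, j ≠ i := fun j hj h => hi (h ▸ hj)
    have step1 := ih (fun j hj => hΦ j (Finset.mem_insert_of_mem hj))
      (fun j hj => hneg j (Finset.mem_insert_of_mem hj))
      (fun j hj => hfix j (Finset.mem_insert_of_mem hj))
      (fun ω => g ω + ε i ω • θ i • y i) (hg.add (hm i _)) (fun j hj ω => by
        simp only [hinv j (Finset.mem_insert_of_mem hj),
          hfix j (Finset.mem_insert_of_mem hj) i (hne j hj).symm])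
    simp only [Finset.sum_insert hi, ← add_assoc]
    refine step1.trans ?_
    have hi' := Finset.mem_insert_self i s
    set F : S → X := fun ω => g ω + ε i ω • y i + ∑ j ∈ s, ε j ω • y j with hF
    have mF : StronglyMeasurable F :=
      (hg.add (hm i _)).add (Finset.stronglyMeasurable_fun_sum _ fun j _ => hm j _)
    have hFΦ : ∀ ω, F (Φ i ω) = g ω - ε i ω • y i + ∑ j ∈ s, ε j ω • y j := by
      intro ω
      simp only [hF, hinv i hi', hneg i hi', neg_smul, ← sub_eq_add_neg]
      congr 1
      exact Finset.sum_congr rfl fun j hj => by rw [hfix i hi' j (hne j hj)]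
    -- `F ∘ Φ i` is `F` with the `i`-th term reversed, so the weights `(1 ± θ i) / 2` turn the
    -- coefficient `1` into `θ i`.
    have e : (fun ω => g ω + ε i ω • θ i • y i + ∑ j ∈ s, ε j ω • y j)
        = ((1 + θ i) / 2) • F + ((1 - θ i) / 2) • (F ∘ Φ i) := by
      ext ω
      simp only [Pi.add_apply, Pi.smul_apply, Function.comp_apply, hFΦ]
      simp only [hF]
      module
    have habs := abs_le.1 (hθ i)
    have mFΦ : AEStronglyMeasurable (F ∘ Φ i) ν :=
      mF.aestronglyMeasurable.comp_measurePreserving (hΦ i hi')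
    rw [e]
    refine (eLpNorm_add_le (mF.const_smul _).aestronglyMeasurable (mFΦ.const_smul _) hp).trans ?_
    rw [eLpNorm_const_smul, eLpNorm_const_smul,
      eLpNorm_comp_measurePreserving mF.aestronglyMeasurable (hΦ i hi'), ← add_mul,
      Real.enorm_eq_ofReal (by linarith), Real.enorm_eq_ofReal (by linarith),
      ← ENNReal.ofReal_add (by linarith) (by linarith),
      show (1 + θ i) / 2 + (1 - θ i) / 2 = 1 by ring, ENNReal.ofReal_one, one_mul]

/-! ### The UMD inequality for differences that are reversed by measure preserving maps -/

section UMD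

variable {X : Type*} [NormedAddCommGroup X] [NormedSpace ℝ X] [CompleteSpace X]

/-- On a set invariant under `Φ`, the change of variables shows that the integral of `d` equals its
own negative. -/
theorem condExp_eq_zero_of_flip {Ω : Type*} {m m₀ : MeasurableSpace Ω} (hm : m ≤ m₀)
    {μ : Measure[m₀] Ω} [IsFiniteMeasure μ] {d : Ω → X} {Φ : Ω → Ω} (hd : Integrable d μ)
    (hΦ : MeasurePreserving Φ μ μ) (hinv : ∀ s, MeasurableSet[m] s → Φ ⁻¹' s = s)
    (hneg : ∀ ω, d (Φ ω) = -d ω) : μ[d | m] =ᵐ[μ] 0 := by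
  symm
  refine ae_eq_condExp_of_forall_setIntegral_eq hm hd (fun s _ _ => integrableOn_zero) ?_
    aestronglyMeasurable_zero
  intro s hs _
  have hs' := hm s hs
  have h1 : ∫ ω in s, d ω ∂μ = ∫ ω, s.indicator d ω ∂μ := (integral_indicator hs').symm
  have h2 : ∫ ω, s.indicator d ω ∂μ = ∫ ω, s.indicator d (Φ ω) ∂μ := by
    conv_lhs => rw [← hΦ.map_eq]
    rw [integral_map hΦ.aemeasurable]
    rw [hΦ.map_eq]
    exact (hd.indicator hs').aestronglyMeasurable
  have h3 : ∀ ω, s.indicator d (Φ ω) = -s.indicator d ω := by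
    intro ω
    have hiff : Φ ω ∈ s ↔ ω ∈ s := by
      rw [← Set.mem_preimage, hinv s hs]
    by_cases h : ω ∈ s
    · rw [Set.indicator_of_mem h, Set.indicator_of_mem (hiff.2 h), hneg]
    · rw [Set.indicator_of_notMem h, Set.indicator_of_notMem (mt hiff.1 h), neg_zero]
  simp only [h3, integral_neg] at h2
  have h4 : ∫ ω, s.indicator d ω ∂μ = 0 := by
    have h5 : (2 : ℝ) • ∫ ω, s.indicator d ω ∂μ = 0 := by
      rw [two_smul]; nth_rewrite 1 [h2]; exact neg_add_cancel _
    simpa using h5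
  rw [h1, h4]; simp

/-- The filtration is generated by the states `π n`. The difference `d (n + 1)` is reversed by a map
that leaves the state `π n` unchanged, so its conditional expectation vanishes. Normalizing `μ`
reduces to a probability measure. -/
theorem UMDInequality.eLpNorm_le {p K : ℝ≥0∞} (hK : UMDInequality p X K)
    {Ω : Type} {m : MeasurableSpace Ω} {μ : Measure Ω} [IsFiniteMeasure μ]
    {T : Type} [MeasurableSpace T] [DiscreteMeasurableSpace T] [Countable T]
    (π : ℕ → Ω → T) (hπ : ∀ n, Measurable (π n))
    (hπs : ∀ n ω ω', π (n + 1) ω = π (n + 1) ω' → π n ω = π n ω')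
    (d : ℕ → Ω → X) (hd : ∀ n ω ω', π n ω = π n ω' → d n ω = d n ω')
    (hbd : ∀ n, ∃ R : ℝ, ∀ ω, ‖d n ω‖ ≤ R)
    (Φ : ℕ → Ω → Ω) (hΦ : ∀ n, MeasurePreserving (Φ n) μ μ)
    (hfix : ∀ n ω, π n (Φ (n + 1) ω) = π n ω)
    (hneg : ∀ n ω, d n (Φ n ω) = -d n ω)
    (ε : ℕ → ℝ) (hε : ∀ n, ε n = 1 ∨ ε n = -1) (N : ℕ) :
    eLpNorm (fun ω => ∑ n ∈ Finset.range N, ε n • d n ω) p μ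
      ≤ K * eLpNorm (fun ω => ∑ n ∈ Finset.range N, d n ω) p μ := by
  rcases eq_or_ne μ 0 with rfl | hμ
  · simp
  have hμ0 : μ Set.univ ≠ 0 := by simpa using hμ
  have hμt : μ Set.univ ≠ ∞ := measure_ne_top _ _
  set P : Measure Ω := (μ Set.univ)⁻¹ • μ with hP
  have : IsProbabilityMeasure P := ⟨by simp [hP, ENNReal.inv_mul_cancel hμ0 hμt]⟩
  let ℱ : Filtration ℕ m :=
    { seq := fun n => MeasurableSpace.comap (π n) inferInstance
      mono' := monotone_nat_of_le_succ fun n => by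
        rintro _ ⟨s, -, rfl⟩
        -- As `π (n + 1)` determines `π n`, a preimage under `π n` is a union of fibres of `π (n +
        -- 1)`, and every subset of the discrete space `T` is measurable.
        refine ⟨π (n + 1) '' (π n ⁻¹' s), MeasurableSet.of_discrete, ?_⟩
        ext ω
        constructor
        · rintro ⟨ω', h', e⟩
          change π n ω ∈ s
          rwa [← hπs n ω' ω e]
        · exact fun h => ⟨ω, h, rfl⟩
      le' := fun n => (hπ n).comap_le }
  have hsm : ∀ n, StronglyMeasurable[ℱ n] (d n) := by
    intro n
    have e : d n = Function.extend (π n) (d n) 0 ∘ π n := by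
      ext ω
      exact (Function.FactorsThrough.extend_apply (fun ω ω' h => hd n ω ω' h) 0 ω).symm
    rw [e]
    exact StronglyMeasurable.of_discrete.comp_measurable (comap_measurable (π n))
  have hmem : ∀ (q : ℝ≥0∞) n, MemLp (d n) q P := by
    intro q n
    obtain ⟨R, hR⟩ := hbd n
    exact MemLp.of_bound ((hsm n).mono (ℱ.le n)).aestronglyMeasurable R (Filter.Eventually.of_forall hR)
  have hint : ∀ n, Integrable (d n) P := fun n =>
    memLp_one_iff_integrable.1 (hmem 1 n)
  have hmds : IsMartingaleDifference (d) ℱ P := by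
    refine ⟨hsm, hint, fun n => ?_⟩
    refine condExp_eq_zero_of_flip (ℱ.le n) (hint (n + 1))
      ((hΦ (n + 1)).smul_measure (μ Set.univ)⁻¹) ?_ (hneg (n + 1))
    rintro _ ⟨s, _, rfl⟩
    ext ω
    simp [hfix]
  have h := hK Ω m P inferInstance ℱ _ hmds (hmem p) ε hε N
  have hc : (μ Set.univ)⁻¹ ≠ 0 := ENNReal.inv_ne_zero.2 hμt
  -- Normalization multiplies both norms by the same finite nonzero power of the total mass, which
  -- cancels.
  rw [hP, eLpNorm_smul_measure_of_ne_zero hc, eLpNorm_smul_measure_of_ne_zero hc, smul_eq_mul,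
    smul_eq_mul, mul_left_comm] at h
  refine (ENNReal.mul_le_mul_iff_right ?_ ?_).1 h
  · exact (ENNReal.rpow_pos (pos_iff_ne_zero.2 hc) (ENNReal.inv_ne_top.2 hμ0)).ne'
  · exact ENNReal.rpow_ne_top_of_nonneg ENNReal.toReal_nonneg (ENNReal.inv_ne_top.2 hμ0)

/-- Adding `1` avoids the question whether the infimum is attained, and keeps the final constant a
function of the UMD constant. -/
theorem exists_umdInequality_of_isUMD {p : ℝ≥0∞} (h : IsUMD p X) :
    UMDInequality p X (umdConstant p X + 1) := by
  have hlt : umdConstant p X < umdConstant p X + 1 := ENNReal.lt_add_right h.ne one_ne_zero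
  obtain ⟨K, hK, hlt'⟩ := sInf_lt_iff.1 hlt
  intro Ω m μ hμ ℱ d hd hmem ε hε N
  exact (hK Ω m μ hμ ℱ d hd hmem ε hε N).trans (mul_le_mul_left hlt'.le _)

end UMD

/-! ### Haar sums and their randomizations -/

section Estimates

variable {X : Type*} [NormedAddCommGroup X] [NormedSpace ℝ X]

omit [NormedSpace ℝ X] in
theorem stronglyMeasurable_coeff (c : ℤ → ℝ) (x : ℤ → ℤ → X) (j : ℤ) :
    StronglyMeasurable fun t => x j (idx c j t) :=
  StronglyMeasurable.of_discrete.comp_measurable (measurable_idx c j)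

/-- The Haar sum with coefficients `x j k` over the levels `a, …, a + N - 1`. -/
noncomputable def haarSum (c : ℤ → ℝ) (x : ℤ → ℤ → X) (a : ℤ) (N : ℕ) (t : ℝ) : X :=
  ∑ n ∈ Finset.range N, rad c (a + n) t • x (a + n) (idx c (a + n) t)

/-- The randomized sum of the coefficient functions, with the signs given by the second
variable. -/
noncomputable def randomSum (c : ℤ → ℝ) (x : ℤ → ℤ → X) (a : ℤ) (N : ℕ) (z : ℝ × ℝ) : X :=
  ∑ n ∈ Finset.range N, rad 0 (a + n) z.2 • x (a + n) (idx c (a + n) z.1)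

theorem stronglyMeasurable_rad (c : ℤ → ℝ) (j : ℤ) : StronglyMeasurable (rad c j) :=
  (measurable_rad c j).stronglyMeasurable

theorem stronglyMeasurable_haarSum (c : ℤ → ℝ) (x : ℤ → ℤ → X) (a : ℤ) (N : ℕ) :
    StronglyMeasurable (haarSum c x a N) :=
  Finset.stronglyMeasurable_fun_sum _ fun _ _ =>
    (stronglyMeasurable_rad _ _).smul (stronglyMeasurable_coeff _ _ _)

theorem stronglyMeasurable_randomSum_smul (c : ℤ → ℝ) (x : ℤ → ℤ → X) (a : ℤ) (N : ℕ)
    (θ : ℤ → ℝ → ℝ) (hθ : ∀ j, Measurable (θ j)) :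
    StronglyMeasurable fun z : ℝ × ℝ => ∑ n ∈ Finset.range N,
      rad 0 (a + n) z.2 • θ (a + n) z.1 • x (a + n) (idx c (a + n) z.1) :=
  Finset.stronglyMeasurable_fun_sum _ fun _ _ =>
    ((stronglyMeasurable_rad _ _).comp_measurable measurable_snd).smul
      (((hθ _).stronglyMeasurable.comp_measurable measurable_fst).smul
        ((stronglyMeasurable_coeff _ _ _).comp_measurable measurable_fst))

theorem stronglyMeasurable_randomSum (c : ℤ → ℝ) (x : ℤ → ℤ → X) (a : ℤ) (N : ℕ) :
    StronglyMeasurable (randomSum c x a N) := by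
  have h := stronglyMeasurable_randomSum_smul c x a N (fun _ _ => 1) fun _ => measurable_const
  simp only [one_smul] at h
  exact h

theorem contraction {p : ℝ≥0∞} (hp : 1 ≤ p) {a : ℤ} {ν : Measure ℝ}
    (hν : ∀ j, a ≤ j → MeasurePreserving (flip 0 j) ν ν) (N : ℕ) (θ : ℕ → ℝ)
    (hθ : ∀ n, |θ n| ≤ 1) (y : ℕ → X) :
    eLpNorm (fun s => ∑ n ∈ Finset.range N, rad 0 (a + n) s • θ n • y n) p ν
      ≤ eLpNorm (fun s => ∑ n ∈ Finset.range N, rad 0 (a + n) s • y n) p ν :=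
  eLpNorm_sum_le_of_flip hp _ (fun n : ℕ => rad 0 (a + n)) (fun n : ℕ => flip 0 (a + n))
    (fun _ => measurable_rad _ _) (fun n _ => hν _ (by omega)) (fun _ _ _ => rad_flip_self _ _ _)
    (fun i _ j hij _ => rad_flip_of_ne nested_zero (by simpa using hij) _) θ hθ y

/-! ### The differences in Bourgain's form of Stein's inequality -/

/-- The indicator of the first (if `η = 1`) or last (if `η = -1`) quarter of the interval of
level `j` containing `t`. -/
noncomputable def quarter (c : ℤ → ℝ) (η : ℝ) (j : ℤ) (t : ℝ) : ℝ :=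
  1 / 4 * (1 + η * rad c j t) * (1 + η * rad c (j + 1) t)

@[fun_prop]
theorem measurable_quarter (c : ℤ → ℝ) (η : ℝ) (j : ℤ) : Measurable (quarter c η j) := by
  unfold quarter; fun_prop

/-- The sign component of level `j`. -/
noncomputable def signPart (c : ℤ → ℝ) (x : ℤ → ℤ → X) (j : ℤ) (z : ℝ × ℝ) : X :=
  (1 / 4 * rad 0 j z.2) • x j (idx c j z.1)

/-- The Haar component of level `j` in the randomized sum over quarters. -/
noncomputable def haarPart (c : ℤ → ℝ) (η : ℝ) (x : ℤ → ℤ → X) (j : ℤ) (z : ℝ × ℝ) : X :=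
  rad c j z.1 • ((1 / 4 * η * rad 0 j z.2) • x j (idx c j z.1) +
    (1 / 4 * (η + rad c (j - 1) z.1) * rad 0 (j - 1) z.2) • x (j - 1) (idx c (j - 1) z.1))

/-- The martingale differences of the randomized sum over quarters. -/
noncomputable def steinDiff (c : ℤ → ℝ) (η : ℝ) (x : ℤ → ℤ → X) (a : ℤ) (n : ℕ) (z : ℝ × ℝ) : X :=
  if Even n then signPart c x (a + (n / 2 : ℕ)) z else haarPart c η x (a + (n / 2 : ℕ)) z

theorem steinDiff_even (c : ℤ → ℝ) (η : ℝ) (x : ℤ → ℤ → X) (a : ℤ) (i : ℕ) (z : ℝ × ℝ) :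
    steinDiff c η x a (2 * i) z = signPart c x (a + i) z := by
  rw [steinDiff, if_pos (even_two_mul i), Nat.mul_div_cancel_left i two_pos]

theorem steinDiff_odd (c : ℤ → ℝ) (η : ℝ) (x : ℤ → ℤ → X) (a : ℤ) (i : ℕ) (z : ℝ × ℝ) :
    steinDiff c η x a (2 * i + 1) z = haarPart c η x (a + i) z := by
  rw [steinDiff, if_neg (by simp), show (2 * i + 1) / 2 = i by omega]

/-- The product defining `quarter` is expanded, and each term is assigned to the finest Haar sign in
it. The term containing `r_{j+1}` thus moves from level `j` to level `j + 1`, and the subtracted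
remainder is what the last level owes to the next one. -/
theorem sum_steinDiff (c : ℤ → ℝ) {η : ℝ} (hη : η * η = 1) (x : ℤ → ℤ → X) (a : ℤ)
    (hxa : x (a - 1) = 0) (N : ℕ) (z : ℝ × ℝ) :
    ∑ n ∈ Finset.range (2 * N), steinDiff c η x a n z =
      ∑ n ∈ Finset.range N,
        rad 0 (a + n) z.2 • quarter c η (a + n) z.1 • x (a + n) (idx c (a + n) z.1)
      - (1 / 4 * rad c (a + N) z.1 * (η + rad c (a + N - 1) z.1) * rad 0 (a + N - 1) z.2) •
        x (a + N - 1) (idx c (a + N - 1) z.1) := by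
  induction N with
  | zero => simp [hxa]
  | succ N ih =>
    rw [mul_add, mul_one, Finset.sum_range_succ, Finset.sum_range_succ, ih, Finset.sum_range_succ,
      steinDiff_even, steinDiff_odd, signPart, haarPart]
    have e : a + ((N + 1 : ℕ) : ℤ) - 1 = a + N := by push_cast; ring
    have e' : a + ((N + 1 : ℕ) : ℤ) = a + N + 1 := by push_cast; ring
    rw [e, e', quarter]
    match_scalars
    · ring
    · ring
    -- `η ^ 2 = 1` is needed only for the product of the two consecutive Haar signs.
    · linear_combination (-1 / 4 * rad 0 (a + N) z.2 * rad c (a + N) z.1 *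
        rad c (a + N + 1) z.1) * hη

/-- The Haar parts have odd index and cancel; each sign part, with its factor `1/4`, is counted
twice. -/
theorem sum_steinDiff_add_alternating (c : ℤ → ℝ) (η : ℝ) (x : ℤ → ℤ → X) (a : ℤ) (N : ℕ)
    (z : ℝ × ℝ) : ∑ n ∈ Finset.range (2 * N), steinDiff c η x a n z +
      ∑ n ∈ Finset.range (2 * N), (-1 : ℝ) ^ n • steinDiff c η x a n z
      = (1 / 2 : ℝ) • randomSum c x a N z := by
  unfold randomSum
  induction N with
  | zero => simp
  | succ N ih =>
    rw [mul_add, mul_one, Finset.sum_range_succ, Finset.sum_range_succ,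
      Finset.sum_range_succ (fun n => (-1 : ℝ) ^ n • _), Finset.sum_range_succ (fun n => _ • _),
      Finset.sum_range_succ (fun n => rad 0 _ _ • _), smul_add, ← ih,
      steinDiff_even, steinDiff_odd, signPart, pow_succ, pow_mul]
    simp only [neg_one_sq, one_pow]
    module

/-! ### The randomized inequalities -/

variable [CompleteSpace X] {p K : ℝ≥0∞}

/-- On one cell of level `a` the Haar terms are martingale differences, the term of each level being
reversed by the flip of that level. -/
theorem haarSum_signs (hK : UMDInequality p X K) (hp : 1 ≤ p) (hp' : p ≠ ∞) {c : ℤ → ℝ}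
    (hc : Nested c) (x : ℤ → ℤ → X) (hx : ∀ j, ∃ R : ℝ, ∀ k, ‖x j k‖ ≤ R) (a : ℤ) (N : ℕ)
    (ε : ℕ → ℝ) (hε : ∀ n, ε n = 1 ∨ ε n = -1) :
    eLpNorm (fun t => ∑ n ∈ Finset.range N, ε n • rad c (a + n) t • x (a + n) (idx c (a + n) t))
      p volume ≤ K * eLpNorm (haarSum c x a N) p volume := by
  refine eLpNorm_le_of_partition hp hp' (measurable_idx c a) fun k => ?_
  have : IsFiniteMeasure (volume.restrict (idx c a ⁻¹' {k})) :=
    ⟨by rw [Measure.restrict_apply_univ, volume_preimage_idx]; exact ENNReal.ofReal_lt_top⟩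
  refine hK.eLpNorm_le (fun n : ℕ => idx c (a + n + 1)) (fun _ => measurable_idx _ _) ?_
    (fun n t => rad c (a + n) t • x (a + n) (idx c (a + n) t)) ?_ ?_
    (fun n => flip c (a + n)) ?_ ?_ ?_ ε hε N
  · exact fun n t t' h => idx_congr hc (by push_cast; omega) h
  · intro n t t' h
    rw [rad_congr hc (lt_add_one _) h, idx_congr hc (by omega) h]
  · intro n
    obtain ⟨R, hR⟩ := hx (a + n)
    refine ⟨R, fun t => ?_⟩
    rw [norm_smul, Real.norm_eq_abs, abs_rad, one_mul]
    exact hR _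
  · exact fun n => measurePreserving_flip_restrict hc (by omega) k
  · intro n t
    exact idx_flip_of_le hc (by push_cast; omega) t
  · intro n t
    rw [rad_flip_self, idx_flip_self, neg_smul]

/-- For a frozen choice of signs, UMD applies to the coefficients multiplied by these signs: the
same signs, applied again, restore the Haar sum. For frozen `t`, contraction then removes the
factors `rad c _ t`. -/
theorem haarSum_le_randomSum (hK : UMDInequality p X K) (hp : 1 ≤ p) (hp' : p ≠ ∞) {c : ℤ → ℝ}
    (hc : Nested c) (x : ℤ → ℤ → X) (hx : ∀ j, ∃ R : ℝ, ∀ k, ‖x j k‖ ≤ R) (a : ℤ) (N : ℕ)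
    {ν : Measure ℝ} [IsProbabilityMeasure ν]
    (hν : ∀ j, a ≤ j → MeasurePreserving (flip 0 j) ν ν) :
    eLpNorm (haarSum c x a N) p volume
      ≤ K * eLpNorm (randomSum c x a N) p (volume.prod ν) := by
  have m1 := stronglyMeasurable_haarSum c x a N
  rw [← eLpNorm_comp_measurePreserving m1.aestronglyMeasurable
    (measurePreserving_fst (μ := (volume : Measure ℝ)) (ν := ν))]
  have m2 := stronglyMeasurable_randomSum_smul c x a N (rad c) (measurable_rad c)
  refine (eLpNorm_prod_le_symm hp hp' (m1.comp_measurable measurable_fst) m2 (K := K) ?_).trans ?_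
  · intro s
    have hx' : ∀ j, ∃ R : ℝ, ∀ k, ‖(fun j k => rad 0 j s • x j k) j k‖ ≤ R := by
      intro j
      obtain ⟨R, hR⟩ := hx j
      refine ⟨R, fun k => ?_⟩
      rw [norm_smul, Real.norm_eq_abs, abs_rad, one_mul]
      exact hR _
    have h := haarSum_signs hK hp hp' hc (fun j k => rad 0 j s • x j k) hx' a N
      (fun n => rad 0 (a + n) s) (fun n => rad_eq _ _ _)
    have e1 : haarSum c (fun j k => rad 0 j s • x j k) a N = fun t =>
        ∑ n ∈ Finset.range N, rad 0 (a + n) s • rad c (a + n) t • x (a + n) (idx c (a + n) t) := by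
      ext t
      exact Finset.sum_congr rfl fun n _ => smul_comm _ _ _
    have e2 : (fun t => ∑ n ∈ Finset.range N, rad 0 (a + n) s • rad c (a + n) t •
        rad 0 (a + n) s • x (a + n) (idx c (a + n) t)) = haarSum c x a N := by
      ext t
      refine Finset.sum_congr rfl fun n _ => ?_
      rw [smul_comm (rad c _ t), smul_smul, rad_mul_self, one_smul]
    rw [e1, e2] at h
    exact h
  · refine mul_le_mul_right ?_ K
    rw [← one_mul (eLpNorm (randomSum c x a N) p _)]
    refine eLpNorm_prod_le hp hp' m2 (stronglyMeasurable_randomSum c x a N) fun t => ?_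
    rw [one_mul]
    exact contraction hp hν N (fun n => rad c (a + n) t) (fun n => (abs_rad _ _ _).le)
      (fun n => x (a + n) (idx c (a + n) t))

/-- For frozen `t`, contraction inserts the factors `rad c _ t`, because their squares are `1`. For
frozen signs, UMD then removes the signs. -/
theorem randomSum_le_haarSum (hK : UMDInequality p X K) (hp : 1 ≤ p) (hp' : p ≠ ∞) {c : ℤ → ℝ}
    (hc : Nested c) (x : ℤ → ℤ → X) (hx : ∀ j, ∃ R : ℝ, ∀ k, ‖x j k‖ ≤ R) (a : ℤ) (N : ℕ)
    {ν : Measure ℝ} [IsProbabilityMeasure ν]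
    (hν : ∀ j, a ≤ j → MeasurePreserving (flip 0 j) ν ν) :
    eLpNorm (randomSum c x a N) p (volume.prod ν)
      ≤ K * eLpNorm (haarSum c x a N) p volume := by
  have m1 := stronglyMeasurable_haarSum c x a N
  rw [← eLpNorm_comp_measurePreserving m1.aestronglyMeasurable
    (measurePreserving_fst (μ := (volume : Measure ℝ)) (ν := ν))]
  have m2 := stronglyMeasurable_randomSum_smul c x a N (rad c) (measurable_rad c)
  have h1 : eLpNorm (randomSum c x a N) p ((volume : Measure ℝ).prod ν)
      ≤ 1 * eLpNorm (fun z : ℝ × ℝ => ∑ n ∈ Finset.range N,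
        rad 0 (a + n) z.2 • rad c (a + n) z.1 • x (a + n) (idx c (a + n) z.1)) p
        (volume.prod ν) := by
    refine eLpNorm_prod_le hp hp' (stronglyMeasurable_randomSum c x a N) m2 fun t => ?_
    rw [one_mul]
    have h := contraction hp hν N (fun n => rad c (a + n) t) (fun n => (abs_rad _ _ _).le)
      (fun n => rad c (a + n) t • x (a + n) (idx c (a + n) t))
    simp only [smul_smul (rad c _ t) (rad c _ t), rad_mul_self, one_smul] at h
    exact h
  rw [one_mul] at h1
  refine h1.trans (eLpNorm_prod_le_symm hp hp' m2 (m1.comp_measurable measurable_fst) fun s => ?_)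
  exact haarSum_signs hK hp hp' hc x hx a N (fun n => rad 0 (a + n) s) (fun n => rad_eq _ _ _)

theorem steinDiff_signs (hK : UMDInequality p X K) (hp : 1 ≤ p) (hp' : p ≠ ∞) {c : ℤ → ℝ}
    (hc : Nested c) {η : ℝ} (x : ℤ → ℤ → X) (hx : ∀ j, ∃ R : ℝ, ∀ k, ‖x j k‖ ≤ R) (a : ℤ) (N : ℕ)
    {ν : Measure ℝ} [IsProbabilityMeasure ν]
    (hν : ∀ j, a ≤ j → MeasurePreserving (flip 0 j) ν ν)
    (ε : ℕ → ℝ) (hε : ∀ n, ε n = 1 ∨ ε n = -1) :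
    eLpNorm (fun z => ∑ n ∈ Finset.range N, ε n • steinDiff c η x a n z) p (volume.prod ν)
      ≤ K * eLpNorm (fun z => ∑ n ∈ Finset.range N, steinDiff c η x a n z) p
        (volume.prod ν) := by
  refine eLpNorm_le_of_partition hp hp' ((measurable_idx c a).comp measurable_fst) fun k => ?_
  have hcell : (volume.prod ν).restrict (idx c a ∘ Prod.fst ⁻¹' {k})
      = (volume.restrict (idx c a ⁻¹' {k})).prod ν := by
    rw [← Measure.restrict_univ (μ := ν), Measure.prod_restrict, Measure.restrict_univ]
    congr 1
    ext z; simp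
  rw [hcell]
  have : IsFiniteMeasure (volume.restrict (idx c a ⁻¹' {k})) :=
    ⟨by rw [Measure.restrict_apply_univ, volume_preimage_idx]; exact ENNReal.ofReal_lt_top⟩
  -- The state refines the two coordinates alternately: an even step reveals the random sign of a
  -- level, the following odd step the Haar sign of the same level. The flips act on the coordinate
  -- being refined.
  refine hK.eLpNorm_le
    (fun (n : ℕ) (z : ℝ × ℝ) =>
      (idx c (a + ((n + 1) / 2 : ℕ)) z.1, idx 0 (a + (n / 2 : ℕ) + 1) z.2))
    (fun n => by fun_prop) ?_ (steinDiff c η x a) ?_ ?_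
    (fun n z => if Even n then (z.1, flip 0 (a + (n / 2 : ℕ)) z.2)
      else (flip c (a + (n / 2 : ℕ)) z.1, z.2)) ?_ ?_ ?_ ε hε N
  · intro n z z' h
    rw [Prod.mk.injEq] at h ⊢
    exact ⟨idx_congr hc (by omega) h.1, idx_congr nested_zero (by omega) h.2⟩
  · intro n z z' h
    rw [Prod.mk.injEq] at h
    rcases Nat.even_or_odd' n with ⟨i, rfl | rfl⟩
    · rw [show (2 * i + 1) / 2 = i by omega, show 2 * i / 2 = i by omega] at h
      rw [steinDiff_even, steinDiff_even, signPart, signPart, h.1,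
        rad_congr nested_zero (lt_add_one _) h.2]
    · rw [show (2 * i + 1 + 1) / 2 = i + 1 by omega, show (2 * i + 1) / 2 = i by omega] at h
      rw [steinDiff_odd, steinDiff_odd, haarPart, haarPart,
        rad_congr nested_zero (lt_add_one _) h.2,
        rad_congr nested_zero (show a + (i : ℤ) - 1 < a + i + 1 by omega) h.2,
        rad_congr hc (show a + (i : ℤ) - 1 < a + ((i + 1 : ℕ) : ℤ) by omega) h.1,
        rad_congr hc (show a + (i : ℤ) < a + ((i + 1 : ℕ) : ℤ) by omega) h.1,
        idx_congr hc (show a + (i : ℤ) - 1 ≤ a + ((i + 1 : ℕ) : ℤ) by omega) h.1,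
        idx_congr hc (show a + (i : ℤ) ≤ a + ((i + 1 : ℕ) : ℤ) by omega) h.1]
  · intro n
    rcases Nat.even_or_odd' n with ⟨i, rfl | rfl⟩
    · obtain ⟨R, hR⟩ := hx (a + i)
      refine ⟨1 / 4 * R, fun z => ?_⟩
      rw [steinDiff_even, signPart, norm_smul, norm_mul, Real.norm_eq_abs (rad _ _ _), abs_rad]
      norm_num
      exact hR _
    · obtain ⟨R, hR⟩ := hx (a + i)
      obtain ⟨R', hR'⟩ := hx (a + i - 1)
      refine ⟨1 / 4 * |η| * R + 1 / 4 * (|η| + 1) * R', fun z => ?_⟩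
      rw [steinDiff_odd, haarPart, norm_smul, Real.norm_eq_abs, abs_rad, one_mul]
      refine (norm_add_le _ _).trans ?_
      simp only [norm_smul, norm_mul, Real.norm_eq_abs, abs_rad, mul_one]
      have h1 := (abs_add_le η (rad c (a + i - 1) z.1)).trans_eq (by rw [abs_rad])
      have e : |(1 / 4 : ℝ)| = 1 / 4 := by norm_num
      rw [e]
      gcongr
      · exact hR _
      · exact hR' _
  · intro n
    split_ifs
    · exact (MeasurePreserving.id _).prod (hν _ (by omega))
    · exact (measurePreserving_flip_restrict hc (by omega) k).prod (MeasurePreserving.id ν)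
  · intro n z
    rcases Nat.even_or_odd n with h | h
    · have h' : ¬Even (n + 1) := by simpa [Nat.even_add_one] using h
      simp only [if_neg h', Prod.mk.injEq, and_true]
      exact idx_flip_of_le hc le_rfl _
    · have h' : Even (n + 1) := h.add_one
      simp only [if_pos h', Prod.mk.injEq, true_and]
      obtain ⟨i, rfl⟩ := h
      exact idx_flip_of_le nested_zero (by omega) _
  · intro n z
    rcases Nat.even_or_odd' n with ⟨i, rfl | rfl⟩
    · rw [if_pos (even_two_mul i), steinDiff_even, steinDiff_even, signPart, signPart,
        show 2 * i / 2 = i by omega, rad_flip_self, mul_neg, neg_smul]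
    · rw [if_neg (by simp), steinDiff_odd, steinDiff_odd, haarPart, haarPart,
        show (2 * i + 1) / 2 = i by omega]
      simp only
      rw [rad_flip_self, idx_flip_self, idx_flip_of_le hc (show a + (i : ℤ) - 1 ≤ a + i by omega),
        rad_flip_of_ne hc (show a + (i : ℤ) - 1 ≠ a + i by omega), neg_smul]

/-- The two vanishing levels remove the boundary terms of `sum_steinDiff`. With `F` the sum over
quarters and `A` its alternating transform, the randomized sum is `2 (F + A)`, and UMD bounds `A` by
`K` times `F`. -/
theorem randomSum_le_quarter (hK : UMDInequality p X K) (hp : 1 ≤ p) (hp' : p ≠ ∞) {c : ℤ → ℝ}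
    (hc : Nested c) {η : ℝ} (hη : η * η = 1) (x : ℤ → ℤ → X)
    (hx : ∀ j, ∃ R : ℝ, ∀ k, ‖x j k‖ ≤ R) (a : ℤ) (N : ℕ)
    (hxa : x (a - 1) = 0) (hxN : x (a + N - 1) = 0) {ν : Measure ℝ} [IsProbabilityMeasure ν]
    (hν : ∀ j, a ≤ j → MeasurePreserving (flip 0 j) ν ν) :
    eLpNorm (randomSum c x a N) p (volume.prod ν)
      ≤ 2 * (1 + K) * eLpNorm (fun z : ℝ × ℝ => ∑ n ∈ Finset.range N,
        rad 0 (a + n) z.2 • quarter c η (a + n) z.1 • x (a + n) (idx c (a + n) z.1)) p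
        (volume.prod ν) := by
  set F := fun z : ℝ × ℝ => ∑ n ∈ Finset.range N,
        rad 0 (a + n) z.2 • quarter c η (a + n) z.1 • x (a + n) (idx c (a + n) z.1) with hF
  have eF : (fun z => ∑ n ∈ Finset.range (2 * N), steinDiff c η x a n z) = F := by
    ext z
    rw [sum_steinDiff c hη x a hxa, hxN]
    simp [hF]
  have mF : StronglyMeasurable F :=
    stronglyMeasurable_randomSum_smul c x a N _ (measurable_quarter c η)
  set A := fun z => ∑ n ∈ Finset.range (2 * N), (-1 : ℝ) ^ n • steinDiff c η x a n z with hA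
  have hAF : eLpNorm A p (volume.prod ν) ≤ K * eLpNorm F p (volume.prod ν) := by
    rw [← eF]
    exact steinDiff_signs hK hp hp' hc x hx a (2 * N) hν _ (neg_one_pow_eq_or ℝ)
  have e : randomSum c x a N = (2 : ℝ) • (F + A) := by
    ext z
    have h := sum_steinDiff_add_alternating c η x a N z
    rw [congrFun eF z] at h
    rw [Pi.smul_apply, Pi.add_apply, hA, h, smul_smul]
    norm_num
  have mA : StronglyMeasurable A := by
    have : A = (1 / 2 : ℝ) • randomSum c x a N - F := by
      rw [e, smul_smul]; norm_num
    rw [this]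
    exact ((stronglyMeasurable_randomSum c x a N).const_smul _).sub mF
  rw [e, eLpNorm_const_smul, mul_assoc, show ‖(2 : ℝ)‖ₑ = 2 by
    rw [Real.enorm_eq_ofReal (by norm_num)]; norm_num]
  gcongr
  refine (eLpNorm_add_le mF.aestronglyMeasurable mA.aestronglyMeasurable hp).trans ?_
  rw [add_mul, one_mul]
  gcongr

/-! ### Comparison of Haar sums over two grids -/

theorem quarter_eq {c : ℤ → ℝ} {η : ℝ} (hη : η * η = 1) (j : ℤ) (t : ℝ) :
    (rad c j t = η ∧ rad c (j + 1) t = η ∧ quarter c η j t = 1) ∨ quarter c η j t = 0 := by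
  have h : η = 1 ∨ η = -1 := mul_self_eq_one_iff.1 hη
  unfold quarter
  rcases h with rfl | rfl <;> rcases rad_eq c j t with h1 | h1 <;>
    rcases rad_eq c (j + 1) t with h2 | h2 <;> rw [h1, h2] <;> norm_num

/-- The chain passes from the Haar sum to the randomized sum, then to its quarters, where the
indices of both grids agree. Contraction drops the quarters in the second grid, and a last use of
UMD returns to a Haar sum. -/
theorem haarSum_le_haarSum (hK : UMDInequality p X K) (hp : 1 ≤ p) (hp' : p ≠ ∞) {c c' : ℤ → ℝ}
    (hc : Nested c) (hc' : Nested c') {η : ℝ} (hη : η * η = 1)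
    (hcc' : ∀ j t, rad c j t = η → rad c (j + 1) t = η → idx c' j t = idx c j t)
    (x : ℤ → ℤ → X) (hx : ∀ j, ∃ R : ℝ, ∀ k, ‖x j k‖ ≤ R) (a : ℤ) (N : ℕ)
    (hxa : x (a - 1) = 0) (hxN : x (a + N - 1) = 0) :
    eLpNorm (haarSum c x a N) p volume
      ≤ K * (2 * (1 + K)) * K * eLpNorm (haarSum c' x a N) p volume := by
  -- The random signs are Haar signs on the single dyadic cell `[0, 2^{-a}[` with normalized
  -- measure, which every flip of level at least `a` preserves.
  set ν : Measure ℝ :=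
    (volume (idx 0 a ⁻¹' {0}))⁻¹ • volume.restrict (idx 0 a ⁻¹' {0}) with hνdef
  have hvol := volume_preimage_idx 0 a 0
  have hpos : (0 : ℝ) < 2 ^ (-a) := by positivity
  have : IsProbabilityMeasure ν := ⟨by
    rw [hνdef, Measure.smul_apply, Measure.restrict_apply_univ, smul_eq_mul]
    refine ENNReal.inv_mul_cancel ?_ ?_ <;> rw [hvol]
    · simpa using hpos
    · exact ENNReal.ofReal_ne_top⟩
  have hν : ∀ j, a ≤ j → MeasurePreserving (flip 0 j) ν ν := fun j haj =>
    (measurePreserving_flip_restrict nested_zero haj 0).smul_measure _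
  have hq : eLpNorm (fun z : ℝ × ℝ => ∑ n ∈ Finset.range N,
        rad 0 (a + n) z.2 • quarter c η (a + n) z.1 • x (a + n) (idx c (a + n) z.1)) p
        (volume.prod ν) ≤ eLpNorm (randomSum c' x a N) p (volume.prod ν) := by
    rw [← one_mul (eLpNorm (randomSum c' x a N) p _)]
    refine eLpNorm_prod_le hp hp'
      (stronglyMeasurable_randomSum_smul c x a N _ (measurable_quarter c η))
      (stronglyMeasurable_randomSum c' x a N) fun t => ?_
    have e : ∀ j, quarter c η j t • x j (idx c j t) = quarter c η j t • x j (idx c' j t) := by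
      intro j
      rcases quarter_eq (c := c) hη j t with ⟨h1, h2, -⟩ | h
      · rw [hcc' j t h1 h2]
      · rw [h, zero_smul, zero_smul]
    simp only [e, one_mul]
    refine contraction hp hν N (fun n => quarter c η (a + n) t) (fun n => ?_)
      (fun n => x (a + n) (idx c' (a + n) t))
    rcases quarter_eq (c := c) hη (a + n) t with ⟨-, -, h⟩ | h <;> simp [h]
  calc eLpNorm (haarSum c x a N) p volume
      ≤ K * eLpNorm (randomSum c x a N) p (volume.prod ν) :=
        haarSum_le_randomSum hK hp hp' hc x hx a N hν
    _ ≤ K * (2 * (1 + K) * (K * eLpNorm (haarSum c' x a N) p volume)) := by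
        gcongr
        refine (randomSum_le_quarter hK hp hp' hc hη x hx a N hxa hxN hν).trans ?_
        gcongr
        exact hq.trans (randomSum_le_haarSum hK hp hp' hc' x hx a N hν)
    _ = _ := by ring

end Estimates

/-! ### Finite Haar sums in `L^p_X` -/

/-- The interval `[c j + 2^{-j} k, c j + 2^{-j} (k + 1)[`. -/
noncomputable def gridInterval (c : ℤ → ℝ) (j k : ℤ) : Interval :=
  ⟨c j + 2 ^ (-j) * k, 2 ^ (-j), by positivity⟩

theorem haarUnit_eq (y : ℝ) :
    haarUnit y = if ⌊y⌋ = 0 then (if Int.fract y < 1 / 2 then 1 else -1) else 0 := by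
  have h2 := Int.floor_add_fract y
  by_cases h : ⌊y⌋ = 0
  · rw [if_pos h]
    rw [h, Int.cast_zero, zero_add] at h2
    rw [h2]
    rw [Int.floor_eq_zero_iff, Set.mem_Ico] at h
    unfold haarUnit
    by_cases h3 : y < 1 / 2
    · rw [if_pos h3, Set.indicator_of_mem (by exact ⟨h.1, h3⟩),
        Set.indicator_of_notMem (fun h4 => by linarith [h4.1])]
      norm_num
    · rw [if_neg h3, Set.indicator_of_notMem (fun h4 => h3 h4.2),
        Set.indicator_of_mem (by exact ⟨not_lt.1 h3, h.2⟩)]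
      norm_num
  · rw [if_neg h]
    rw [Int.floor_eq_zero_iff] at h
    rw [haarUnit, Set.indicator_of_notMem
      (fun h4 => h (by exact ⟨h4.1, by linarith [h4.2]⟩)),
      Set.indicator_of_notMem (fun h4 => h (by exact ⟨by linarith [h4.1], h4.2⟩)), sub_zero]

theorem haar_gridInterval (c : ℤ → ℝ) (j k : ℤ) (t : ℝ) :
    haar (gridInterval c j k) t = if idx c j t = k then rad c j t else 0 := by
  have e : (t - (gridInterval c j k).left) / (gridInterval c j k).length = coord c j t - k := by
    simp only [gridInterval, coord, zpow_neg]
    have : (2 : ℝ) ^ j ≠ 0 := by positivity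
    field_simp
    ring
  rw [haar, e, haarUnit_eq, Int.floor_sub_intCast, Int.fract_sub_intCast, idx, rad]
  simp only [sub_eq_zero]

variable {X : Type*} [NormedAddCommGroup X] [NormedSpace ℝ X]

theorem haarLp_coeFn (p : ℝ≥0∞) (I : Interval) (x : X) :
    haarLp p I x =ᵐ[volume] fun t => haar I t • x :=
  (memLp_haar_smul p I x).coeFn_toLp

/-- `x ↦ h_I x` as a linear map. -/
noncomputable def haarLinear (p : ℝ≥0∞) (I : Interval) :
    X →ₗ[ℝ] Lp X p (volume : Measure ℝ) where
  toFun := haarLp p I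
  map_add' x y := by
    simp only [haarLp, smul_add]
    exact (memLp_haar_smul p I x).toLp_add (memLp_haar_smul p I y)
  map_smul' r x := by
    simp only [haarLp, smul_comm _ r x]
    exact (memLp_haar_smul p I x).toLp_const_smul r

/-- The finite Haar sum with given coefficients, as an element of `L^p_X`. -/
noncomputable def haarSynthesis (p : ℝ≥0∞) (X : Type*) [NormedAddCommGroup X] [NormedSpace ℝ X]
    (c : ℤ → ℝ) : ((ℤ × ℤ) →₀ X) →ₗ[ℝ] Lp X p (volume : Measure ℝ) :=
  Finsupp.lsum ℝ fun i => haarLinear p (gridInterval c i.1 i.2)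

theorem haarSynthesis_single (p : ℝ≥0∞) (c : ℤ → ℝ) (j k : ℤ) (x : X) :
    haarSynthesis p X c (Finsupp.single (j, k) x) = haarLp p (gridInterval c j k) x :=
  Finsupp.lsum_single ℝ _ _ _

theorem haarSynthesis_coeFn (p : ℝ≥0∞) (c : ℤ → ℝ) (x : (ℤ × ℤ) →₀ X) :
    haarSynthesis p X c x =ᵐ[volume]
      fun t => ∑ i ∈ x.support, haar (gridInterval c i.1 i.2) t • x i := by
  classical
  have h : ∀ s : Finset (ℤ × ℤ),
      (∑ i ∈ s, haarLp p (gridInterval c i.1 i.2) (x i) : Lp X p (volume : Measure ℝ))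
        =ᵐ[volume] fun t => ∑ i ∈ s, haar (gridInterval c i.1 i.2) t • x i := by
    intro s
    induction s using Finset.induction_on with
    | empty =>
      simp only [Finset.sum_empty]
      exact Lp.coeFn_zero X p (volume : Measure ℝ)
    | insert i s hi ih =>
      simp only [Finset.sum_insert hi]
      filter_upwards [Lp.coeFn_add (haarLp p (gridInterval c i.1 i.2) (x i))
        (∑ i ∈ s, haarLp p (gridInterval c i.1 i.2) (x i)), ih,
        haarLp_coeFn p (gridInterval c i.1 i.2) (x i)] with t h1 h2 h3
      rw [h1, Pi.add_apply, h2, h3]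
  exact h x.support

/-- At each `t` only the one cell per level that contains `t` contributes. -/
theorem sum_haar_eq_haarSum (c : ℤ → ℝ) (x : (ℤ × ℤ) →₀ X) (a : ℤ) (N : ℕ)
    (hx : ∀ i ∈ x.support, a ≤ i.1 ∧ i.1 < a + N) (t : ℝ) :
    ∑ i ∈ x.support, haar (gridInterval c i.1 i.2) t • x i
      = haarSum c (fun j k => x (j, k)) a N t := by
  classical
  set φ : ℕ → ℤ × ℤ := fun n => (a + n, idx c (a + n) t) with hφ
  have hinj : Function.Injective φ := by
    intro m n h
    have := congrArg Prod.fst h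
    simp only [hφ] at this
    omega
  have e : haarSum c (fun j k => x (j, k)) a N t
      = ∑ i ∈ (Finset.range N).image φ, haar (gridInterval c i.1 i.2) t • x i := by
    rw [Finset.sum_image hinj.injOn]
    refine Finset.sum_congr rfl fun n _ => ?_
    rw [haar_gridInterval, if_pos rfl]
  rw [e]
  refine Finset.sum_congr_of_eq_on_inter ?_ ?_ fun _ _ _ => rfl
  · rintro ⟨j, k⟩ hi hn
    rw [haar_gridInterval, if_neg, zero_smul]
    intro h
    apply hn
    have h1 : a ≤ j ∧ j < a + N := hx _ hi
    refine Finset.mem_image.2 ⟨(j - a).toNat, Finset.mem_range.2 (by omega), ?_⟩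
    have e1 : a + ((j - a).toNat : ℤ) = j := by omega
    simp only [hφ, e1, h]
  · intro i _ hn
    rw [Finsupp.notMem_support_iff.1 hn, smul_zero]

theorem enorm_haarSynthesis (p : ℝ≥0∞) (c : ℤ → ℝ) (x : (ℤ × ℤ) →₀ X) (a : ℤ) (N : ℕ)
    (hx : ∀ i ∈ x.support, a ≤ i.1 ∧ i.1 < a + N) :
    ‖haarSynthesis p X c x‖ₑ = eLpNorm (haarSum c (fun j k => x (j, k)) a N) p volume := by
  rw [Lp.enorm_def, eLpNorm_congr_ae (haarSynthesis_coeFn p c x)]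
  congr 1
  ext t
  exact sum_haar_eq_haarSum c x a N hx t

-- The range of levels is one longer than the support needs: the empty top level absorbs the terms
-- that the regrouping in `sum_steinDiff` pushes up by one level.
omit [NormedSpace ℝ X] in
theorem exists_levels (x : (ℤ × ℤ) →₀ X) :
    ∃ (a : ℤ) (N : ℕ), ∀ i ∈ x.support, a ≤ i.1 ∧ i.1 < a + N - 1 := by
  refine ⟨-∑ i ∈ x.support, |i.1|, (2 * ∑ i ∈ x.support, |i.1| + 2).toNat, fun i hi => ?_⟩
  have h : |i.1| ≤ ∑ i ∈ x.support, |i.1| :=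
    Finset.single_le_sum (f := fun i : ℤ × ℤ => |i.1|) (fun _ _ => abs_nonneg _) hi
  have h2 := abs_le.1 h
  omega

theorem norm_haarSynthesis_le [CompleteSpace X] {p K : ℝ≥0∞} (hK : UMDInequality p X K)
    (hK' : K ≠ ∞) (hp : 1 ≤ p) (hp' : p ≠ ∞) {c c' : ℤ → ℝ} (hc : Nested c) (hc' : Nested c')
    {η : ℝ} (hη : η * η = 1)
    (hcc' : ∀ j t, rad c j t = η → rad c (j + 1) t = η → idx c' j t = idx c j t)
    (x : (ℤ × ℤ) →₀ X) :
    ‖haarSynthesis p X c x‖ ≤ K.toReal * (2 * (1 + K.toReal)) * K.toReal *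
      ‖haarSynthesis p X c' x‖ := by
  obtain ⟨a, N, haN⟩ := exists_levels x
  have hx : ∀ i ∈ x.support, a ≤ i.1 ∧ i.1 < a + N := fun i hi => by
    have := haN i hi; omega
  have hbd : ∀ j, ∃ R : ℝ, ∀ k, ‖(fun j k => x (j, k)) j k‖ ≤ R := by
    intro j
    refine ⟨∑ i ∈ x.support, ‖x i‖, fun k => ?_⟩
    by_cases h : (j, k) ∈ x.support
    · exact Finset.single_le_sum (f := fun i => ‖x i‖) (fun _ _ => norm_nonneg _) h
    · simp only
      rw [Finsupp.notMem_support_iff.1 h, norm_zero]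
      exact Finset.sum_nonneg fun _ _ => norm_nonneg _
  have hzero : ∀ j, (j < a ∨ a + N - 1 ≤ j) → (fun k => x (j, k)) = 0 := by
    intro j hj
    ext k
    rw [Pi.zero_apply, ← Finsupp.notMem_support_iff]
    intro h
    have h1 : a ≤ j ∧ j < a + N - 1 := haN _ h
    omega
  have h := haarSum_le_haarSum hK hp hp' hc hc' hη hcc' (fun j k => x (j, k)) hbd a N
    (hzero _ (Or.inl (by omega))) (hzero _ (Or.inr le_rfl))
  rw [← enorm_haarSynthesis p c x a N hx, ← enorm_haarSynthesis p c' x a N hx] at h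
  have hfin : K * (2 * (1 + K)) * K * ‖haarSynthesis p X c' x‖ₑ ≠ ∞ := by
    have : 1 + K ≠ ∞ := ENNReal.add_ne_top.2 ⟨ENNReal.one_ne_top, hK'⟩
    exact ENNReal.mul_ne_top (ENNReal.mul_ne_top (ENNReal.mul_ne_top hK'
      (ENNReal.mul_ne_top ENNReal.ofNat_ne_top this)) hK') enorm_ne_top
  have h2 := ENNReal.toReal_mono hfin h
  have e : ∀ f : Lp X p (volume : Measure ℝ), ‖f‖ₑ.toReal = ‖f‖ := fun f => by
    rw [Lp.enorm_def, Lp.norm_def]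
  simpa only [ENNReal.toReal_mul, e, ENNReal.toReal_ofNat,
    ENNReal.toReal_add ENNReal.one_ne_top hK', ENNReal.toReal_one] using h2

/-! ### Density of the Haar sums -/

section Density

variable {X : Type*} [NormedAddCommGroup X] {p : ℝ≥0∞}

theorem volume_preimage_idx_ne_top (c : ℤ → ℝ) (j k : ℤ) : volume (idx c j ⁻¹' {k}) ≠ ∞ := by
  rw [volume_preimage_idx]; exact ENNReal.ofReal_ne_top

/-- The function `1_I x` in `L^p_X`, for the interval `I` of level `j` and index `k`. -/
noncomputable def cellLp (p : ℝ≥0∞) (c : ℤ → ℝ) (j k : ℤ) (x : X) :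
    Lp X p (volume : Measure ℝ) :=
  indicatorConstLp p (measurable_idx c j (measurableSet_singleton k))
    (volume_preimage_idx_ne_top c j k) x

theorem cellLp_coeFn (c : ℤ → ℝ) (j k : ℤ) (x : X) :
    cellLp p c j k x =ᵐ[volume] fun t => if idx c j t = k then x else 0 := by
  filter_upwards [indicatorConstLp_coeFn (p := p)
    (hs := measurable_idx c j (measurableSet_singleton k))
    (hμs := volume_preimage_idx_ne_top c j k) (c := x)] with t ht
  rw [cellLp, ht]
  by_cases h : idx c j t = k
  · rw [if_pos h, Set.indicator_of_mem (by exact h)]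
  · rw [if_neg h, Set.indicator_of_notMem (by exact h)]

theorem norm_cellLp (hp : p ≠ 0) (hp' : p ≠ ∞) (c : ℤ → ℝ) (j k : ℤ) (x : X) :
    ‖cellLp p c j k x‖ = ‖x‖ * ((2 : ℝ) ^ (-j)) ^ (1 / p.toReal) := by
  rw [cellLp, norm_indicatorConstLp hp hp', measureReal_def, volume_preimage_idx,
    ENNReal.toReal_ofReal (by positivity)]

variable [NormedSpace ℝ X]

/-- The indicator of a half is `(1_I ± h_I) / 2`, where `I` is the parent cell. -/
theorem cellLp_succ {c : ℤ → ℝ} (hc : Nested c) (j k : ℤ) (x : X) :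
    ∃ (k' : ℤ) (σ : ℝ), cellLp p c (j + 1) k x = (1 / 2 : ℝ) • cellLp p c j k' x +
      (σ / 2) • haarLp p (gridInterval c j k') x := by
  obtain ⟨n, hn⟩ := idx_succ hc j
  refine ⟨(k - n) / 2, if (k - n) % 2 = 0 then 1 else -1, ?_⟩
  ext1
  set k' := (k - n) / 2 with hk'
  set σ : ℝ := if (k - n) % 2 = 0 then 1 else -1 with hσ
  have hiff : ∀ t, idx c (j + 1) t = k ↔ idx c j t = k' ∧ rad c j t = σ := by
    intro t
    rw [hn t, hσ]
    rcases rad_eq c j t with h | h <;> rw [h]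
    · rw [if_pos rfl]
      split_ifs with h2
      · simp only [and_true]; omega
      · norm_num; omega
    · rw [if_neg (by norm_num)]
      split_ifs with h2
      · norm_num; omega
      · simp only [and_true]; omega
  have hσ' : σ = 1 ∨ σ = -1 := by rw [hσ]; split_ifs <;> simp
  filter_upwards [Lp.coeFn_add ((1 / 2 : ℝ) • cellLp p c j k' x)
      ((σ / 2) • haarLp p (gridInterval c j k') x),
    Lp.coeFn_smul (1 / 2 : ℝ) (cellLp p c j k' x),
    Lp.coeFn_smul (σ / 2) (haarLp p (gridInterval c j k') x),
    cellLp_coeFn (p := p) c (j + 1) k x, cellLp_coeFn (p := p) c j k' x,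
    haarLp_coeFn p (gridInterval c j k') x] with t h1 h2 h3 h4 h5 h6
  rw [h1, Pi.add_apply, h2, h3, Pi.smul_apply, Pi.smul_apply, h4, h5, h6, haar_gridInterval,
    if_congr (hiff t) rfl rfl]
  by_cases h : idx c j t = k'
  · simp only [h, true_and, if_true]
    rcases hσ' with hs | hs <;> rcases rad_eq c j t with hr | hr <;> rw [hs, hr]
    · rw [if_pos rfl]; module
    · rw [if_neg (by norm_num)]; module
    · rw [if_neg (by norm_num)]; module
    · rw [if_pos rfl]; module
  · simp [h]

/-- Iterating `cellLp_succ` towards coarser cells expresses an indicator as a Haar sum plus its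
average over a large ancestor. -/
theorem cellLp_ancestor {c : ℤ → ℝ} (hc : Nested c) (j k : ℤ) (x : X) (n : ℕ) :
    ∃ v ∈ LinearMap.range (haarSynthesis p X c), ∃ k' : ℤ,
      cellLp p c j k x = v + (1 / 2 : ℝ) ^ n • cellLp p c (j - n) k' x := by
  induction n with
  | zero => exact ⟨0, zero_mem _, k, by simp⟩
  | succ n ih =>
    obtain ⟨v, hv, k', h⟩ := ih
    obtain ⟨k'', σ, h2⟩ := cellLp_succ (p := p) hc (j - n - 1) k' x
    rw [sub_add_cancel] at h2
    refine ⟨v + (1 / 2 : ℝ) ^ n • (σ / 2) • haarLp p (gridInterval c (j - n - 1) k'') x,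
      add_mem hv (Submodule.smul_mem _ _ (Submodule.smul_mem _ _
        ⟨Finsupp.single (j - n - 1, k'') x, haarSynthesis_single _ _ _ _ _⟩)), k'', ?_⟩
    rw [h, h2, show j - ((n + 1 : ℕ) : ℤ) = j - n - 1 by push_cast; ring]
    module

variable [Fact (1 ≤ p)]

theorem cellLp_mem_closure (hp : 1 < p) (hp' : p ≠ ∞) {c : ℤ → ℝ} (hc : Nested c) (j k : ℤ)
    (x : X) : cellLp p c j k x ∈ (LinearMap.range (haarSynthesis p X c)).topologicalClosure := by
  choose v hv k' h using cellLp_ancestor (p := p) hc j k x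
  have hpr : 1 < p.toReal := by
    rw [← ENNReal.toReal_one]
    exact (ENNReal.toReal_lt_toReal ENNReal.one_ne_top hp').2 hp
  have hlim : Filter.Tendsto v Filter.atTop (nhds (cellLp p c j k x)) := by
    rw [tendsto_iff_norm_sub_tendsto_zero]
    -- Each generation halves the coefficient and multiplies the norm of the indicator by `2^{1/p}`.
    -- The remainder decays because `p > 1`.
    set r : ℝ := (2 : ℝ) ^ (1 / p.toReal) / 2 with hr
    have hr1 : r < 1 := by
      rw [hr, div_lt_one two_pos]
      calc (2 : ℝ) ^ (1 / p.toReal) < 2 ^ (1 : ℝ) :=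
            Real.rpow_lt_rpow_of_exponent_lt one_lt_two (by rw [div_lt_one] <;> linarith)
        _ = 2 := Real.rpow_one 2
    have e : ∀ n, ‖v n - cellLp p c j k x‖
        = ‖x‖ * ((2 : ℝ) ^ (-j)) ^ (1 / p.toReal) * r ^ n := by
      intro n
      have e1 : v n - cellLp p c j k x = -((1 / 2 : ℝ) ^ n • cellLp p c (j - n) (k' n) x) := by
        rw [h n]; abel
      have e2 : ((2 : ℝ) ^ n) ^ (1 / p.toReal) = ((2 : ℝ) ^ (1 / p.toReal)) ^ n :=
        (Real.rpow_pow_comm (by norm_num) _ _).symm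
      rw [e1, norm_neg, norm_smul, norm_cellLp (zero_lt_one.trans hp).ne' hp',
        show (2 : ℝ) ^ (-(j - (n : ℤ))) = 2 ^ (-j) * 2 ^ n by
          rw [neg_sub, sub_eq_neg_add, zpow_add₀ (by norm_num), zpow_natCast],
        Real.mul_rpow (by positivity) (by positivity), hr, div_pow,
        e2, Real.norm_of_nonneg (by positivity), one_pow, div_pow]
      ring
    simp only [e]
    rw [← mul_zero (‖x‖ * ((2 : ℝ) ^ (-j)) ^ (1 / p.toReal))]
    exact (tendsto_pow_atTop_nhds_zero_of_lt_one (by positivity) hr1).const_mul _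
  exact mem_closure_of_tendsto hlim (Filter.Eventually.of_forall hv)

theorem exists_step_mem_closure (hp : 1 < p) (hp' : p ≠ ∞) {c : ℤ → ℝ} (hc : Nested c) (j : ℤ)
    (F : ℤ → X) (S : Finset ℤ) (hF : ∀ k, k ∉ S → F k = 0) :
    ∃ w ∈ (LinearMap.range (haarSynthesis p X c)).topologicalClosure,
      w =ᵐ[volume] fun t => F (idx c j t) := by
  classical
  refine ⟨∑ k ∈ S, cellLp p c j k (F k),
    Submodule.sum_mem _ fun k _ => cellLp_mem_closure hp hp' hc j k (F k), ?_⟩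
  have h : ∀ S : Finset ℤ, (∑ k ∈ S, cellLp p c j k (F k) : Lp X p (volume : Measure ℝ))
      =ᵐ[volume] fun t => if idx c j t ∈ S then F (idx c j t) else 0 := by
    intro S
    induction S using Finset.induction_on with
    | empty =>
      simp only [Finset.sum_empty, Finset.notMem_empty, if_false]
      exact Lp.coeFn_zero X p (volume : Measure ℝ)
    | insert k S hk ih =>
      rw [Finset.sum_insert hk]
      filter_upwards [Lp.coeFn_add (cellLp p c j k (F k)) (∑ k ∈ S, cellLp p c j k (F k)), ih,
        cellLp_coeFn (p := p) c j k (F k)] with t h1 h2 h3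
      rw [h1, Pi.add_apply, h2, h3]
      by_cases h4 : idx c j t = k
      · simp [h4, hk]
      · simp [h4]
  filter_upwards [h S] with t ht
  rw [ht]
  split_ifs with h1
  · rfl
  · exact (hF _ h1).symm

theorem exists_mem_closure_eLpNorm_sub_le (hp : 1 < p) (hp' : p ≠ ∞) {c : ℤ → ℝ} (hc : Nested c)
    {g : ℝ → X} (hg : Continuous g) (hs : HasCompactSupport g) {ε : ℝ≥0∞} (hε : ε ≠ 0) :
    ∃ w ∈ (LinearMap.range (haarSynthesis p X c)).topologicalClosure,
      eLpNorm (g - (w : ℝ → X)) p volume ≤ ε := by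
  obtain ⟨R, hR⟩ := hs.isCompact.isBounded.subset_closedBall 0
  have hgR : ∀ t, R < |t| → g t = 0 := by
    intro t ht
    refine image_eq_zero_of_notMem_tsupport fun h => ?_
    have := hR h
    rw [mem_closedBall_zero_iff, Real.norm_eq_abs] at this
    linarith
  -- The margin `1` exceeds the support radius by at least one mesh width: if `t` lies outside `E`,
  -- the left endpoint of its cell still lies outside the support.
  set E : Set ℝ := Set.Icc (-(R + 1)) (R + 1) with hE
  set M : ℝ≥0∞ := volume E ^ (1 / p.toReal) with hM
  have hMt : M ≠ ∞ := ENNReal.rpow_ne_top_of_nonneg (by positivity)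
    (by rw [hE, Real.volume_Icc]; exact ENNReal.ofReal_ne_top)
  obtain ⟨δ, hδ, hδM⟩ : ∃ δ : ℝ, 0 < δ ∧ ENNReal.ofReal δ * M ≤ ε := by
    obtain ⟨δ, hδ, h⟩ := ENNReal.exists_nnreal_pos_mul_lt hMt hε
    exact ⟨δ, by exact_mod_cast hδ, by rw [ENNReal.ofReal_coe_nnreal]; exact h.le⟩
  obtain ⟨η, hη, huc⟩ := Metric.uniformContinuous_iff.1 (hs.uniformContinuous_of_continuous hg) δ hδ
  obtain ⟨n, hn⟩ := exists_pow_lt_of_lt_one hη (show (1 / 2 : ℝ) < 1 by norm_num)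
  have hn' : (2 : ℝ) ^ (-(n : ℤ)) < η := by
    rwa [zpow_neg, zpow_natCast, ← inv_pow, ← one_div]
  have hn1 : (2 : ℝ) ^ (-(n : ℤ)) ≤ 1 := by
    rw [zpow_neg, zpow_natCast]
    exact inv_le_one_of_one_le₀ (one_le_pow₀ one_le_two)
  set l : ℤ → ℝ := fun k => c n + 2 ^ (-(n : ℤ)) * k with hl
  have hpos : (0 : ℝ) < 2 ^ (n : ℤ) := by positivity
  have hlt : ∀ t, l (idx c n t) ≤ t ∧ t < l (idx c n t) + 2 ^ (-(n : ℤ)) := fun t =>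
    (idx_eq_iff c n _ t).1 rfl
  obtain ⟨w, hw, hwF⟩ := exists_step_mem_closure hp hp' hc n (fun k => g (l k))
    (Finset.Icc ⌈(2 : ℝ) ^ (n : ℤ) * (-R - c n)⌉ ⌊(2 : ℝ) ^ (n : ℤ) * (R - c n)⌋) (by
      intro k hk
      refine hgR _ (not_le.1 fun h => hk ?_)
      have e : (k : ℝ) = 2 ^ (n : ℤ) * (l k - c n) := by
        rw [hl, zpow_neg]; field_simp; ring
      obtain ⟨h1, h2⟩ := abs_le.1 h
      rw [Finset.mem_Icc, Int.ceil_le, Int.le_floor, e]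
      constructor <;> gcongr)
  refine ⟨w, hw, le_trans ?_ hδM⟩
  have hbound : ∀ᵐ t ∂volume, ‖(g - (w : ℝ → X)) t‖ ≤ ‖E.indicator (fun _ => δ) t‖ := by
    filter_upwards [hwF] with t ht
    rw [Pi.sub_apply, ht]
    obtain ⟨h1, h2⟩ := hlt t
    by_cases htE : t ∈ E
    · rw [Set.indicator_of_mem htE, Real.norm_of_nonneg hδ.le, ← dist_eq_norm]
      refine (huc ?_).le
      rw [Real.dist_eq, abs_of_nonneg (by linarith)]
      linarith
    · rw [Set.indicator_of_notMem htE, norm_zero]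
      have h3 : R + 1 < |t| := by
        by_contra! h
        exact htE (abs_le.1 h)
      have h4 : R < |l (idx c n t)| := by
        have h5 := abs_sub_abs_le_abs_sub t (l (idx c n t))
        rw [abs_of_nonneg (show 0 ≤ t - l (idx c n t) by linarith)] at h5
        linarith
      rw [hgR t (by linarith), hgR _ h4, sub_zero, norm_zero]
  refine (eLpNorm_mono_ae hbound).trans ?_
  rw [eLpNorm_indicator_const measurableSet_Icc (zero_lt_one.trans hp).ne' hp',
    Real.enorm_eq_ofReal hδ.le]

theorem denseRange_haarSynthesis (hp : 1 < p) (hp' : p ≠ ∞) {c : ℤ → ℝ} (hc : Nested c) :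
    DenseRange (haarSynthesis p X c) := by
  intro f
  suffices h : f ∈ closure
      ((LinearMap.range (haarSynthesis p X c)).topologicalClosure : Set (Lp X p volume)) by
    rw [Submodule.topologicalClosure_coe, closure_closure] at h
    exact h
  rw [EMetric.mem_closure_iff]
  intro ε hε
  have hε4 : ε / 2 / 2 ≠ 0 := by simp [hε.ne']
  obtain ⟨g, hgs, hfg, hg, hgm⟩ :=
    (Lp.memLp f).exists_hasCompactSupport_eLpNorm_sub_le hp' hε4
  obtain ⟨w, hw, hgw⟩ := exists_mem_closure_eLpNorm_sub_le (p := p) hp hp' hc hg hgs hε4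
  refine ⟨w, hw, ?_⟩
  rcases eq_or_ne ε ∞ with rfl | hε'
  · exact edist_lt_top _ _
  refine lt_of_le_of_lt ?_ (ENNReal.half_lt_self hε.ne' hε')
  rw [Lp.edist_def, ← ENNReal.add_halves (ε / 2), ← sub_add_sub_cancel (f : ℝ → X) g w]
  exact (eLpNorm_add_le ((Lp.memLp f).sub hgm).1 (hgm.sub (Lp.memLp w)).1 hp.le).trans
    (add_le_add hfg hgw)

end Density

/-! ### Grids at relative distance at most three quarters of the length -/

/-- By nestedness the position inside a cell evolves by the doubling map, so two successive signs
`rad` are the first two binary digits of that position. -/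
theorem fract_coord_succ {c : ℤ → ℝ} (hc : Nested c) (j : ℤ) (t : ℝ) :
    Int.fract (coord c (j + 1) t) = Int.fract (2 * Int.fract (coord c j t)) := by
  obtain ⟨n, hn⟩ := hc j
  have e : coord c (j + 1) t
      = 2 * Int.fract (coord c j t) + ((2 * ⌊coord c j t⌋ + n : ℤ) : ℝ) := by
    have h := Int.floor_add_fract (coord c j t)
    push_cast
    rw [← hn]
    have h2 : coord c (j + 1) t = 2 * coord c j t + (2 : ℝ) ^ (j + 1) * (c j - c (j + 1)) := by
      unfold coord; rw [two_zpow_succ]; ring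
    linarith
  rw [e, Int.fract_add_intCast]

/-- In the last quarter the fractional part of the coordinate is at least `3/4`, so subtracting a
displacement of at most `3/4` does not change the floor. -/
theorem idx_eq_of_last_quarter {c c' : ℤ → ℝ} (hc : Nested c)
    (h : ∀ j, 0 ≤ (2 : ℝ) ^ j * (c' j - c j) ∧ (2 : ℝ) ^ j * (c' j - c j) ≤ 3 / 4) (j : ℤ) (t : ℝ)
    (h1 : rad c j t = -1) (h2 : rad c (j + 1) t = -1) : idx c' j t = idx c j t := by
  have f0 := Int.floor_add_fract (coord c j t)
  have f1 := Int.fract_lt_one (coord c j t)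
  have g1 : ¬Int.fract (coord c j t) < 1 / 2 := fun hlt => by
    rw [rad, if_pos hlt] at h1; norm_num at h1
  have g2 : ¬Int.fract (coord c (j + 1) t) < 1 / 2 := fun hlt => by
    rw [rad, if_pos hlt] at h2; norm_num at h2
  have e : Int.fract (2 * Int.fract (coord c j t)) = 2 * Int.fract (coord c j t) - 1 := by
    rw [Int.fract_eq_iff]
    exact ⟨by linarith, by linarith, 1, by norm_num⟩
  rw [fract_coord_succ hc, e] at g2
  have e2 : coord c' j t = coord c j t - 2 ^ j * (c' j - c j) := by unfold coord; ring
  obtain ⟨h3, h4⟩ := h j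
  rw [idx, idx, Int.floor_eq_iff, e2]
  constructor <;> linarith

theorem idx_eq_of_first_quarter {c c' : ℤ → ℝ} (hc : Nested c)
    (h : ∀ j, 0 ≤ (2 : ℝ) ^ j * (c j - c' j) ∧ (2 : ℝ) ^ j * (c j - c' j) ≤ 3 / 4) (j : ℤ) (t : ℝ)
    (h1 : rad c j t = 1) (h2 : rad c (j + 1) t = 1) : idx c' j t = idx c j t := by
  have f0 := Int.floor_add_fract (coord c j t)
  have f1 := Int.fract_nonneg (coord c j t)
  have g1 : Int.fract (coord c j t) < 1 / 2 := by
    by_contra hlt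
    rw [rad, if_neg hlt] at h1; norm_num at h1
  have g2 : Int.fract (coord c (j + 1) t) < 1 / 2 := by
    by_contra hlt
    rw [rad, if_neg hlt] at h2; norm_num at h2
  have e : Int.fract (2 * Int.fract (coord c j t)) = 2 * Int.fract (coord c j t) := by
    rw [Int.fract_eq_self]
    exact ⟨by linarith, by linarith⟩
  rw [fract_coord_succ hc, e] at g2
  have e2 : coord c' j t = coord c j t + 2 ^ j * (c j - c' j) := by unfold coord; ring
  obtain ⟨h3, h4⟩ := h j
  rw [idx, idx, Int.floor_eq_iff, e2]
  constructor <;> linarith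

/-! ### The isomorphism carrying one Haar system to another -/

/-- The isomorphism constant in terms of the UMD constant. -/
noncomputable def shiftConstant (K : ℝ≥0∞) : ℝ :=
  (K.toReal + 1) * (2 * (1 + (K.toReal + 1))) * (K.toReal + 1)

theorem shiftConstant_pos (K : ℝ≥0∞) : 0 < shiftConstant K := by
  have : 0 ≤ K.toReal := ENNReal.toReal_nonneg
  unfold shiftConstant; positivity

/-- The two bounds make `A v ↦ B v` well defined and bounded in both directions between dense
subspaces; density also gives uniqueness. -/
theorem exists_equiv_of_denseRange {V E : Type*} [AddCommGroup V] [Module ℝ V]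
    [NormedAddCommGroup E] [NormedSpace ℝ E] [CompleteSpace E] {A B : V →ₗ[ℝ] E}
    (hA : DenseRange A) (hB : DenseRange B) {C : ℝ} (hC : 0 < C)
    (hAB : ∀ v, ‖A v‖ ≤ C * ‖B v‖) (hBA : ∀ v, ‖B v‖ ≤ C * ‖A v‖) :
    ∃ S : E ≃L[ℝ] E, (∀ T : E →L[ℝ] E, (∀ v, T (A v) = B v) ↔ T = S) ∧
      ∀ u, C⁻¹ * ‖u‖ ≤ ‖S u‖ ∧ ‖S u‖ ≤ C * ‖u‖ := by
  obtain ⟨S, hS⟩ : ∃ S : E ≃L[ℝ] E, ∀ v, S (A v) = B v :=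
    ⟨(LinearEquiv.refl ℝ V).extend A B hA ⟨C, hBA⟩ hB ⟨C, hAB⟩,
      LinearEquiv.extend_eq (LinearEquiv.refl ℝ V) A B hA ⟨C, hBA⟩ hB ⟨C, hAB⟩⟩
  refine ⟨S, fun T => ⟨fun hT => ?_, ?_⟩, fun u => ?_⟩
  · exact DFunLike.coe_injective (hA.equalizer T.continuous S.continuous
      (funext fun v => (hT v).trans (hS v).symm))
  · rintro rfl
    exact hS
  · refine hA.induction_on (p := fun u => C⁻¹ * ‖u‖ ≤ ‖S u‖ ∧ ‖S u‖ ≤ C * ‖u‖) u ?_ fun v => ?_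
    · exact (isClosed_le (f := fun u => C⁻¹ * ‖u‖) (g := fun u => ‖S u‖)
        (by fun_prop) (by fun_prop)).inter (isClosed_le (f := fun u => ‖S u‖)
        (g := fun u => C * ‖u‖) (by fun_prop) (by fun_prop))
    · rw [hS, inv_mul_le_iff₀ hC]
      exact ⟨hAB v, hBA v⟩

section Isomorphism

variable {X : Type*} [NormedAddCommGroup X] [NormedSpace ℝ X] [CompleteSpace X] {p : ℝ≥0∞}

theorem norm_haarSynthesis_le_of_shift (hX : IsUMD p X) (hp : 1 ≤ p) (hp' : p ≠ ∞)
    {c c' : ℤ → ℝ} (hc : Nested c) (hc' : Nested c')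
    (h : ∀ j, 0 ≤ (2 : ℝ) ^ j * (c' j - c j) ∧ (2 : ℝ) ^ j * (c' j - c j) ≤ 3 / 4)
    (x : (ℤ × ℤ) →₀ X) :
    ‖haarSynthesis p X c x‖ ≤ shiftConstant (umdConstant p X) * ‖haarSynthesis p X c' x‖ ∧
    ‖haarSynthesis p X c' x‖ ≤ shiftConstant (umdConstant p X) * ‖haarSynthesis p X c x‖ := by
  have hK := exists_umdInequality_of_isUMD hX
  have hK' : umdConstant p X + 1 ≠ ∞ := ENNReal.add_ne_top.2 ⟨hX.ne, ENNReal.one_ne_top⟩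
  have e : (umdConstant p X + 1).toReal = (umdConstant p X).toReal + 1 := by
    rw [ENNReal.toReal_add hX.ne ENNReal.one_ne_top, ENNReal.toReal_one]
  rw [shiftConstant, ← e]
  -- `c'` lies to the right of `c`: the cells share the last quarter of the `c`-cell, and, with the
  -- roles exchanged, the first quarter of the `c'`-cell.
  exact ⟨norm_haarSynthesis_le hK hK' hp hp' hc hc' (η := -1) (by norm_num)
    (idx_eq_of_last_quarter hc h) x,
    norm_haarSynthesis_le hK hK' hp hp' hc' hc (η := 1) (by norm_num)
    (idx_eq_of_first_quarter hc' h) x⟩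

omit [CompleteSpace X] in
theorem eq_haarSynthesis_iff [Fact (1 ≤ p)] (c c' : ℤ → ℝ)
    (T : Lp X p (volume : Measure ℝ) →L[ℝ] Lp X p (volume : Measure ℝ)) :
    (∀ x, T (haarSynthesis p X c x) = haarSynthesis p X c' x) ↔
      ∀ j k x, T (haarLp p (gridInterval c j k) x) = haarLp p (gridInterval c' j k) x := by
  constructor
  · intro h j k x
    rw [← haarSynthesis_single, ← haarSynthesis_single]
    exact h _
  · intro h x
    have hlin : T.toLinearMap ∘ₗ haarSynthesis p X c = haarSynthesis p X c' := by
      refine Finsupp.lhom_ext fun i x => ?_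
      obtain ⟨j, k⟩ := i
      rw [LinearMap.comp_apply, haarSynthesis_single, haarSynthesis_single]
      exact h j k x
    exact LinearMap.congr_fun hlin x

end Isomorphism

/-! ### The one-third-shifted grid -/

theorem gridInterval_zero (j k : ℤ) : gridInterval 0 j k = dyadic j k := by
  ext <;> simp [gridInterval, dyadic]

theorem dyadic_mem (j k : ℤ) : dyadic j k ∈ dyadicGrid :=
  Set.mem_iUnion.2 ⟨j, k, rfl⟩

/-- The offsets `c` for which the interval of level `j` and index `k` is `σ₁` of the dyadic
interval of level `j` and index `k`. -/
noncomputable def offsetOne (j : ℤ) : ℝ := if Even j then 2 ^ (-j) / 3 else 2 * 2 ^ (-j) / 3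

/-- The offsets `c` for which the interval of level `j` and index `k` is `σ₀` of the dyadic
interval of level `j` and index `k`. -/
noncomputable def offsetZero (j : ℤ) : ℝ := offsetOne j - 2 ^ (-j)

theorem two_zpow_mul_neg (j : ℤ) : (2 : ℝ) ^ j * 2 ^ (-j) = 1 := by
  rw [← zpow_add₀ (by norm_num)]; simp

theorem two_zpow_neg_succ (j : ℤ) : (2 : ℝ) ^ (-(j + 1)) = 2 ^ (-j) / 2 := by
  rw [neg_add, zpow_add₀ (by norm_num)]; norm_num; ring

theorem offsetOne_mem (j : ℤ) :
    0 ≤ (2 : ℝ) ^ j * offsetOne j ∧ (2 : ℝ) ^ j * offsetOne j ≤ 3 / 4 := by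
  have h := two_zpow_mul_neg j
  unfold offsetOne
  split_ifs <;> constructor <;> linarith

/-- The alternation of the thirds makes the grid nested: between levels `j` and `j + 1` the offset
changes by no cell of level `j + 1` if `j` is even, and by exactly one if `j` is odd. -/
theorem nested_offsetOne : Nested offsetOne := by
  intro j
  have h := two_zpow_mul_neg j
  by_cases hj : Even j
  · refine ⟨0, ?_⟩
    have hj' : ¬Even (j + 1) := by simpa [Int.even_add_one] using hj
    rw [offsetOne, offsetOne, if_pos hj, if_neg hj', two_zpow_neg_succ]
    push_cast; ring
  · refine ⟨1, ?_⟩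
    have hj' : Even (j + 1) := by simpa [Int.even_add_one] using hj
    rw [offsetOne, offsetOne, if_neg hj, if_pos hj', two_zpow_neg_succ, two_zpow_succ]
    push_cast; linarith

theorem nested_offsetZero : Nested offsetZero := by
  intro j
  obtain ⟨n, hn⟩ := nested_offsetOne j
  have h := two_zpow_mul_neg j
  refine ⟨n - 1, ?_⟩
  push_cast
  rw [← hn, offsetZero, offsetZero, two_zpow_neg_succ, two_zpow_succ]
  linarith

theorem offsetZero_mem (j : ℤ) :
    0 ≤ (2 : ℝ) ^ j * (0 - offsetZero j) ∧ (2 : ℝ) ^ j * (0 - offsetZero j) ≤ 3 / 4 := by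
  have h := two_zpow_mul_neg j
  unfold offsetZero offsetOne
  split_ifs <;> constructor <;> linarith

/-- For odd `j` the shift goes to the left, so the shifted interval that starts inside a given cell
is the translate of the next cell, whence `m = 1`. -/
theorem offsetOne_eq (j : ℤ) : ∃ m : ℤ, offsetOne j = shiftWidth j + 2 ^ (-j) * m := by
  by_cases hj : Even j
  · exact ⟨0, by rw [offsetOne, if_pos hj, shiftWidth, hj.neg_one_zpow]; push_cast; ring⟩
  · refine ⟨1, ?_⟩
    rw [offsetOne, if_neg hj, shiftWidth, (Int.not_even_iff_odd.1 hj).neg_one_zpow]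
    push_cast; ring

theorem gridInterval_mem_shiftedGrid {c : ℤ → ℝ} {j m : ℤ}
    (hc : c j = shiftWidth j + 2 ^ (-j) * m) (k : ℤ) : gridInterval c j k ∈ shiftedGrid := by
  refine Set.mem_iUnion.2 ⟨j, dyadic j (k + m), ⟨k + m, rfl⟩, ?_⟩
  ext
  · simp only [Interval.translate, dyadic, gridInterval, hc]
    push_cast; ring
  · rfl

theorem sigmaOne_dyadic (j k : ℤ) :
    (sigmaOne ⟨dyadic j k, dyadic_mem j k⟩ : Interval) = gridInterval offsetOne j k := by
  have h := existsUnique_shifted_left_mem (dyadic j k) (dyadic_mem j k)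
  refine h.unique h.choose_spec.1 ⟨?_, rfl, ?_⟩
  · obtain ⟨m, hm⟩ := offsetOne_eq j
    exact gridInterval_mem_shiftedGrid hm k
  · have hpos : (0 : ℝ) < 2 ^ (-j) := by positivity
    simp only [gridInterval, Interval.toSet, Interval.right, dyadic, Set.mem_Ico]
    unfold offsetOne
    split_ifs <;> constructor <;> linarith

theorem sigmaZero_dyadic (j k : ℤ) :
    (sigmaZero ⟨dyadic j k, dyadic_mem j k⟩ : Interval) = gridInterval offsetZero j k := by
  have h := existsUnique_shifted_right_mem (dyadic j k) (dyadic_mem j k)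
  refine h.unique h.choose_spec.1 ⟨?_, rfl, ?_⟩
  · obtain ⟨m, hm⟩ := offsetOne_eq j
    exact gridInterval_mem_shiftedGrid (m := m - 1)
      (by rw [offsetZero, hm]; push_cast; ring) k
  · have hpos : (0 : ℝ) < 2 ^ (-j) := by positivity
    simp only [gridInterval, Interval.toSet, Interval.right, dyadic, Set.mem_Ico]
    unfold offsetZero offsetOne
    split_ifs <;> constructor <;> linarith

theorem actsOnHaarBy_iff {p : ℝ≥0∞} [Fact (1 ≤ p)] {X : Type*} [NormedAddCommGroup X]
    [NormedSpace ℝ X] {τ : dyadicGrid → shiftedGrid} {c : ℤ → ℝ}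
    (hτ : ∀ j k, (τ ⟨dyadic j k, dyadic_mem j k⟩ : Interval) = gridInterval c j k)
    (T : Lp X p (volume : Measure ℝ) →L[ℝ] Lp X p (volume : Measure ℝ)) :
    ActsOnHaarBy τ T ↔
      ∀ j k x, T (haarLp p (gridInterval 0 j k) x) = haarLp p (gridInterval c j k) x := by
  constructor
  · intro h j k x
    rw [gridInterval_zero, ← hτ]
    exact h ⟨dyadic j k, dyadic_mem j k⟩ x
  · rintro h ⟨I, hI⟩ x
    obtain ⟨j, k, rfl⟩ := Set.mem_iUnion.1 hI
    rw [hτ, ← h, gridInterval_zero]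

end OneThird

theorem mainTheorem6 :
    ∃ C : ℝ≥0∞ → ℝ, (∀ K, 0 < C K) ∧
      ∀ (p : ℝ≥0∞) [Fact (1 ≤ p)], 1 < p → p < ∞ →
      ∀ (X : Type*) [NormedAddCommGroup X] [NormedSpace ℝ X] [CompleteSpace X],
        OneThird.IsUMD p X →
        ∃ S₀ S₁ : Lp X p (volume : Measure ℝ) ≃L[ℝ] Lp X p (volume : Measure ℝ),
          (∀ T : Lp X p (volume : Measure ℝ) →L[ℝ] Lp X p (volume : Measure ℝ),
            OneThird.ActsOnHaarBy OneThird.sigmaZero T ↔ T = S₀) ∧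
          (∀ T : Lp X p (volume : Measure ℝ) →L[ℝ] Lp X p (volume : Measure ℝ),
            OneThird.ActsOnHaarBy OneThird.sigmaOne T ↔ T = S₁) ∧
          ∀ u : Lp X p (volume : Measure ℝ),
            ((C (OneThird.umdConstant p X))⁻¹ * ‖u‖ ≤ ‖S₀ u‖ ∧
              ‖S₀ u‖ ≤ C (OneThird.umdConstant p X) * ‖u‖) ∧
            ((C (OneThird.umdConstant p X))⁻¹ * ‖u‖ ≤ ‖S₁ u‖ ∧
              ‖S₁ u‖ ≤ C (OneThird.umdConstant p X) * ‖u‖) := by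
  open OneThird in
  refine ⟨shiftConstant, shiftConstant_pos, fun p _ hp hp' X _ _ _ hX => ?_⟩
  -- `offsetZero` displaces to the left, so here the dyadic grid plays the part of the right-hand
  -- grid `c'`.
  have b₀ := norm_haarSynthesis_le_of_shift hX hp.le hp'.ne nested_offsetZero nested_zero
    offsetZero_mem
  have b₁ := norm_haarSynthesis_le_of_shift hX hp.le hp'.ne nested_zero nested_offsetOne
    (fun j => by simpa using offsetOne_mem j)
  have d : ∀ {c}, Nested c → DenseRange (haarSynthesis p X c) := denseRange_haarSynthesis hp hp'.ne
  obtain ⟨S₀, hS₀, hb₀⟩ := exists_equiv_of_denseRange (d nested_zero) (d nested_offsetZero)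
    (shiftConstant_pos (umdConstant p X)) (fun x => (b₀ x).2) (fun x => (b₀ x).1)
  obtain ⟨S₁, hS₁, hb₁⟩ := exists_equiv_of_denseRange (d nested_zero) (d nested_offsetOne)
    (shiftConstant_pos (umdConstant p X)) (fun x => (b₁ x).1) (fun x => (b₁ x).2)
  refine ⟨S₀, S₁, fun T => ?_, fun T => ?_, fun u => ⟨hb₀ u, hb₁ u⟩⟩
  · rw [actsOnHaarBy_iff sigmaZero_dyadic, ← eq_haarSynthesis_iff, hS₀]
  · rw [actsOnHaarBy_iff sigmaOne_dyadic, ← eq_haarSynthesis_iff, hS₁]
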